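/- Let $k$ be a field of characteristic zero, let $G,M$ be finite groups with $M$ acting on $G$ by automorphisms, $(s,u)\mapsto s\triangleright u$, and let $X=G\rtimes M$, whose elements are written $vt$ with $v\in G$, $t\in M$, so that $su=(s\triangleright u)s$. Let $A=k(M)\,{\blacktriangleright\!\!<}\,kG$ be the cross coproduct Hopf algebra: it has basis $\delta_s\otimes u$ ($s\in M$, $u\in G$) and $$(\delta_s\otimes u)(\delta_t\otimes v)=\delta_{s,t}\,\delta_s\otimes uv,\quad \Delta(\delta_s\otimes u)=\sum_{ab=s}(\delta_a\otimes b\triangleright u)\otimes(\delta_b\otimes u),\quad \varepsilon(\delta_s\otimes u)=\delta_{s,e},\quad S(\delta_s\otimes u)=\delta_{s^{-1}}\otimes(s\triangleright u)^{-1}.$$ Let $H=A^*$ have the dual basis $s\otimes\delta_u$. Put $\mathcal N(vt)=v^{-1}t^{-1}v$ and let $X$ act on the right on the vector space $kX$ by $vt\,\tilde\triangleleft\, us=(s^{-1}\triangleright vu)\,s^{-1}ts$. Let $\Pi:kX\to H$, $\Pi(vt)=t\otimes\delta_v-\delta_{v,e}1_H$. A bicovariant calculus on $A$ is an $A$-bimodule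 and $A$-bicomodule $\Omega^1$ whose coactions are bimodule maps, together with a linear bicomodule map $d:A\to\Omega^1$ obeying the Leibniz rule and such that the elements $a\,db$ span $\Omega^1$; its dimension is that of the space $\Lambda^1$ of left-invariant forms; it is irreducible if it is nonzero and has no proper nonzero quotient calculus. Its quantum tangent space is the image $L\subset H$ of $(\Lambda^1)^*$ under the adjoint of $A\to\Lambda^1$, $a\mapsto S(a_{(1)})\,da_{(2)}$. Let $t_0\in M$, let $\mathcal C_0^M$ be the conjugacy class of $t_0^{-1}$ in $M$ and $\mathcal C_0^X$ that of $t_0^{-1}$ in $X$. Let $N_0=\{u\in G: t_0\triangleright u=u\}$, a subgroup of $G$, let $\mathrm{cent}(t_0)$ be the centralizer of $t_0$ in $M$, $X_0$ the centralizer of $t_0$ in $X$, and $J_0=k\,\mathcal N^{-1}(t_0^{-1})\subset kX$. Then: (i) $\mathcal C_0^X=\{u^{-1}(t\triangleright u)\,t : t\in\mathcal C_0^M,\ u\in G\}$. (ii) $\mathcal N^{-1}(t_0^{-1})=N_0\,t_0$. (iii) $X_0=N_0\cdot\mathrm{cent}(t_0)$. (iv) $X_0$ preserves $J_0=kN_0t_0$,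 and $vt_0\,\tilde\triangleleft\,us=(s^{-1}\triangleright vu)\,t_0$ for all $v,u\in N_0$, $s\in\mathrm{cent}(t_0)$. (v) The element $m_0=\sum_{v\in N_0}vt_0$ spans a one-dimensional trivial $X_0$-subrepresentation of $J_0$. For any choice of elements $\bar z\in X$ with $\bar z^{-1}t_0^{-1}\bar z=z$ for $z\in\mathcal C_0^X$, the span $\mathcal M$ of all $m_0\,\tilde\triangleleft\,x$ $(x\in X)$ is $\mathcal M=\bigoplus_{z\in\mathcal C_0^X}k\,(m_0\,\tilde\triangleleft\,\bar z)$, each summand being one-dimensional, and $\mathcal M$ depends only on the conjugacy class of $t_0$ in $M$. There is a bicovariant calculus on $A$ with quantum tangent space $\Pi(\mathcal M)$, unique up to isomorphism. If $t_0\neq e$ it is irreducible, and its dimension and that of $\Pi(\mathcal M)$ are $|\mathcal C_0^X|$; if $t_0=e$ it is the null calculus $\Omega^1=0$. Thus every conjugacy class of $M$ other than $\{e\}$ defines a canonical irreducible calculus on $A$, of dimension $|\mathcal C_0^X|$. -/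

import Mathlib

open scoped TensorProduct

noncomputable section

/-! ## Bicovariant first order differential calculi over a Hopf algebra -/

namespace NCCalc

/-- A first order differential calculus over the `k`-algebra `A`: an `A`-`A`-bimodule `Ω`
(the two actions being algebra maps into `End_k Ω` that commute), with a linear map
`d : A → Ω` obeying the Leibniz rule, such that `a ⊗ b ↦ a d b` is onto. -/
structure Calculus.{w, u, v} (k : Type u) (A : Type v) [Field k] [Ring A] [Algebra k A] where
  /-- the space of 1-forms -/
  Ω : Type w
  [grp : AddCommGroup Ω]
  [mod : Module k Ω]
  /-- left multiplication of forms by elements of `A` -/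
  lact : A →ₐ[k] Module.End k Ω
  /-- right multiplication of forms by elements of `A` -/
  ract : Aᵐᵒᵖ →ₐ[k] Module.End k Ω
  lact_ract : ∀ (a b : A) (ω : Ω),
    lact a (ract (MulOpposite.op b) ω) = ract (MulOpposite.op b) (lact a ω)
  /-- the exterior derivative -/
  d : A →ₗ[k] Ω
  leibniz : ∀ a b : A, d (a * b) = lact a (d b) + ract (MulOpposite.op b) (d a)
  span_d : Submodule.span k {ω : Ω | ∃ a b : A, ω = lact a (d b)} = ⊤

attribute [instance] Calculus.grp Calculus.mod

/-- Left multiplication as a bilinear map `(a, ω) ↦ a ω`. -/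
def Calculus.lmul {k A : Type*} [Field k] [Ring A] [Algebra k A] (Γ : Calculus k A) :
    A →ₗ[k] Γ.Ω →ₗ[k] Γ.Ω :=
  Γ.lact.toLinearMap

/-- Right multiplication as a bilinear map `(a, ω) ↦ ω a`. -/
def Calculus.rmul {k A : Type*} [Field k] [Ring A] [Algebra k A] (Γ : Calculus k A) :
    A →ₗ[k] Γ.Ω →ₗ[k] Γ.Ω :=
  Γ.ract.toLinearMap ∘ₗ (MulOpposite.opLinearEquiv k : A ≃ₗ[k] Aᵐᵒᵖ).toLinearMap

/-- A bicovariant calculus over a Hopf algebra `A`: the 1-forms are an `A`-`A`-bicomodule, the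
coactions are bimodule maps (for the diagonal bimodule structures of `A ⊗ Ω` and `Ω ⊗ A`), and
`d` is a bicomodule map. -/
structure BicovariantCalculus.{w, u, v} (k : Type u) (A : Type v) [Field k] [Ring A]
    [HopfAlgebra k A] extends Calculus.{w, u, v} k A where
  /-- the left coaction -/
  coL : Ω →ₗ[k] A ⊗[k] Ω
  /-- the right coaction -/
  coR : Ω →ₗ[k] Ω ⊗[k] A
  coL_counit : ∀ ω, TensorProduct.lid k Ω ((Coalgebra.counit (R := k)).rTensor Ω (coL ω)) = ω
  coL_coassoc : ∀ ω, TensorProduct.assoc k A A Ω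
    ((Coalgebra.comul (R := k)).rTensor Ω (coL ω)) = coL.lTensor A (coL ω)
  coR_counit : ∀ ω, TensorProduct.rid k Ω ((Coalgebra.counit (R := k)).lTensor Ω (coR ω)) = ω
  coR_coassoc : ∀ ω, TensorProduct.assoc k Ω A A (coR.rTensor A (coR ω)) =
    (Coalgebra.comul (R := k)).lTensor Ω (coR ω)
  coL_coR : ∀ ω, TensorProduct.assoc k A Ω A (coL.rTensor A (coR ω)) =
    coR.lTensor A (coL ω)
  coL_lmul : ∀ (a : A) (ω : Ω), coL (lact a ω) =
    TensorProduct.map₂ (LinearMap.mul k A) toCalculus.lmul (Coalgebra.comul (R := k) a) (coL ω)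
  coL_rmul : ∀ (a : A) (ω : Ω), coL (ract (MulOpposite.op a) ω) =
    TensorProduct.map₂ (LinearMap.mul k A).flip toCalculus.rmul (Coalgebra.comul (R := k) a)
      (coL ω)
  coR_lmul : ∀ (a : A) (ω : Ω), coR (lact a ω) =
    TensorProduct.map₂ toCalculus.lmul (LinearMap.mul k A) (Coalgebra.comul (R := k) a) (coR ω)
  coR_rmul : ∀ (a : A) (ω : Ω), coR (ract (MulOpposite.op a) ω) =
    TensorProduct.map₂ toCalculus.rmul (LinearMap.mul k A).flip (Coalgebra.comul (R := k) a)
      (coR ω)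
  coL_d : ∀ a : A, coL (d a) = d.lTensor A (Coalgebra.comul (R := k) a)
  coR_d : ∀ a : A, coR (d a) = d.rTensor A (Coalgebra.comul (R := k) a)

namespace BicovariantCalculus

universe w w'

variable {k A : Type*} [Field k] [Ring A] [HopfAlgebra k A]

/-- The space `Λ¹` of left-invariant 1-forms. -/
def invariantForms (Γ : BicovariantCalculus k A) : Submodule k Γ.Ω where
  carrier := {ω | Γ.coL ω = 1 ⊗ₜ[k] ω}
  add_mem' := by
    intro a b ha hb
    simp only [Set.mem_ofPred_eq] at ha hb ⊢
    rw [map_add, ha, hb, TensorProduct.tmul_add]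
  zero_mem' := by simp
  smul_mem' := by
    intro c a ha
    simp only [Set.mem_ofPred_eq] at ha ⊢
    rw [map_smul, ha, TensorProduct.tmul_smul]

/-- The dimension of a calculus: that of its space of left-invariant 1-forms. -/
def dimension (Γ : BicovariantCalculus k A) : ℕ := Module.finrank k Γ.invariantForms

/-- The map `ϖ : A → Λ¹`, `ϖ a = S(a₁) d a₂`, which restricts to the projection of
`A⁺ = ker ε` onto `Λ¹`. -/
def maurerCartan (Γ : BicovariantCalculus k A) : A →ₗ[k] Γ.Ω :=
  TensorProduct.lift (Γ.lmul.compl₁₂ (HopfAlgebra.antipode k) Γ.d) ∘ₗ Coalgebra.comul (R := k)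

/-- The quantum tangent space, as a subspace of the linear dual `H = A*`: the image of the dual
of `Λ¹` under the adjoint of the projection `a ↦ ϖ (a - ε a) = ϖ a`. It lies in
`H⁺ = {h | h 1 = 0}`. -/
def tangentSpace (Γ : BicovariantCalculus k A) : Submodule k (Module.Dual k A) :=
  LinearMap.range Γ.maurerCartan.dualMap

/-- A calculus is irreducible if it is nonzero and has no proper quotients: a sub-bimodule of
the 1-forms which is also a sub-bicomodule is zero or everything. -/
def IsIrreducible (Γ : BicovariantCalculus k A) : Prop :=
  Nontrivial Γ.Ω ∧ ∀ N : Submodule k Γ.Ω,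
    (∀ a : A, ∀ ω ∈ N, Γ.lact a ω ∈ N) →
    (∀ a : A, ∀ ω ∈ N, Γ.ract (MulOpposite.op a) ω ∈ N) →
    (∀ ω ∈ N, Γ.coL ω ∈ LinearMap.range (N.subtype.lTensor A)) →
    (∀ ω ∈ N, Γ.coR ω ∈ LinearMap.range (N.subtype.rTensor A)) →
    N = ⊥ ∨ N = ⊤

/-- Isomorphism of bicovariant calculi: a linear isomorphism of the spaces of 1-forms which
respects the bimodule and bicomodule structures and the exterior derivatives. -/
def Isomorphic (Γ : BicovariantCalculus.{w} k A) (Γ' : BicovariantCalculus.{w'} k A) : Prop :=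
  ∃ f : Γ.Ω ≃ₗ[k] Γ'.Ω,
    (∀ (a : A) (ω : Γ.Ω), f (Γ.lact a ω) = Γ'.lact a (f ω)) ∧
    (∀ (a : A) (ω : Γ.Ω),
      f (Γ.ract (MulOpposite.op a) ω) = Γ'.ract (MulOpposite.op a) (f ω)) ∧
    (∀ a : A, f (Γ.d a) = Γ'.d a) ∧
    (∀ ω : Γ.Ω, Γ'.coL (f ω) = f.toLinearMap.lTensor A (Γ.coL ω)) ∧
    (∀ ω : Γ.Ω, Γ'.coR (f ω) = f.toLinearMap.rTensor A (Γ.coR ω))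

end BicovariantCalculus

/-! ## The cross coproduct Hopf algebra of a semidirect product -/

/-- The cross coproduct `k(M) ◁< kG` attached to an action `φ` of `M` on `G` by automorphisms.
As an algebra it is `k(M) ⊗ kG`, that is, functions on `M` with values in the group algebra
`kG` with the pointwise product. -/
def CrossCoproduct {G M : Type*} [Group G] [Group M] (k : Type*) [Field k]
    (_φ : M →* MulAut G) : Type _ :=
  M → MonoidAlgebra k G

namespace CrossCoproduct

variable {G M : Type*} [Group G] [Group M] (k : Type*) [Field k] (φ : M →* MulAut G)

instance : Ring (CrossCoproduct k φ) := inferInstanceAs (Ring (M → MonoidAlgebra k G))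

instance : Algebra k (CrossCoproduct k φ) :=
  inferInstanceAs (Algebra k (M → MonoidAlgebra k G))

/-- The functional dual to `δ_s ⊗ u`, that is, the basis element `s ⊗ δ_u` of the dual Hopf
algebra `H = kM ▷◀ k(G)`, the linear dual of `k(M) ◁< kG`. -/
def coord (s : M) (u : G) : CrossCoproduct k φ →ₗ[k] k where
  toFun a := MonoidAlgebra.coeff ((a : M → MonoidAlgebra k G) s) u
  map_add' _ _ := rfl
  map_smul' _ _ := rfl

variable [DecidableEq M]

/-- The basis element `δ_s ⊗ u`. -/
def δ (s : M) (u : G) : CrossCoproduct k φ :=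
  (Pi.single s (MonoidAlgebra.single u (1 : k)) : M → MonoidAlgebra k G)

variable {k φ}

/-- Product: `(δ_s ⊗ u)(δ_t ⊗ v) = δ_{s,t} (δ_s ⊗ uv)`. -/
theorem δ_mul (s t : M) (u v : G) :
    δ k φ s u * δ k φ t v = if s = t then δ k φ s (u * v) else 0 := by
  funext r
  change (Pi.single s (MonoidAlgebra.single u (1 : k)) : M → MonoidAlgebra k G) r *
    (Pi.single t (MonoidAlgebra.single v (1 : k)) : M → MonoidAlgebra k G) r = _
  by_cases hst : s = t
  · subst hst
    rw [if_pos rfl]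
    by_cases hr : r = s
    · subst hr
      simp [δ, MonoidAlgebra.single_mul_single]
    · simp [δ, Pi.single_eq_of_ne hr]
  · rw [if_neg hst]
    by_cases hr : r = s
    · subst hr
      rw [Pi.single_eq_of_ne hst, mul_zero]
      rfl
    · rw [Pi.single_eq_of_ne hr, zero_mul]
      rfl

theorem hom_ext [Finite M] {W : Type*} [AddCommMonoid W] [Module k W]
    {f g : CrossCoproduct k φ →ₗ[k] W} (h : ∀ s u, f (δ k φ s u) = g (δ k φ s u)) : f = g := by
  refine LinearMap.pi_ext' (R := k) (φ := fun _ : M => MonoidAlgebra k G) fun s => ?_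
  refine MonoidAlgebra.lhom_ext' fun u => ?_
  refine LinearMap.ext_ring ?_
  exact h s u

theorem one_eq [Fintype M] : (1 : CrossCoproduct k φ) = ∑ s : M, δ k φ s 1 := by
  have h := Finset.univ_sum_single (fun _ : M => (1 : MonoidAlgebra k G))
  exact h.symm

variable [DecidableEq G]

theorem coord_δ (s t : M) (u v : G) :
    coord k φ s u (δ k φ t v) = if t = s ∧ v = u then 1 else 0 := by
  change MonoidAlgebra.coeff
    ((Pi.single t (MonoidAlgebra.single v (1 : k)) : M → MonoidAlgebra k G) s) u = _
  by_cases h : t = s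
  · subst h
    simp [MonoidAlgebra.coeff_single, Finsupp.single_apply]
  · simp [h]

variable [Fintype G] [Fintype M]

variable (k φ) in
/-- The linear map with prescribed values on the basis. -/
def lift {W : Type*} [AddCommMonoid W] [Module k W] (f : M → G → W) :
    CrossCoproduct k φ →ₗ[k] W :=
  ∑ s : M, ∑ u : G, (coord k φ s u).smulRight (f s u)

@[simp]
theorem lift_δ {W : Type*} [AddCommMonoid W] [Module k W] (f : M → G → W) (s : M) (u : G) :
    lift k φ f (δ k φ s u) = f s u := by
  simp only [lift, LinearMap.sum_apply, LinearMap.smulRight_apply, coord_δ]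
  rw [Finset.sum_eq_single s, Finset.sum_eq_single u]
  · simp
  · intro v _ hv
    simp [Ne.symm hv]
  · simp
  · intro t _ ht
    simp [Ne.symm ht]
  · simp

/-- `Δ(δ_s ⊗ u) = ∑_{ab = s} (δ_a ⊗ b▷u) ⊗ (δ_b ⊗ u)`, `ε(δ_s ⊗ u) = δ_{s,e}`. -/
instance : CoalgebraStruct k (CrossCoproduct k φ) where
  comul := lift k φ fun s u =>
    ∑ a : M, δ k φ a (φ (a⁻¹ * s) u) ⊗ₜ[k] δ k φ (a⁻¹ * s) u
  counit := lift k φ fun s _ => if s = 1 then 1 else 0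

theorem comul_δ (s : M) (u : G) : Coalgebra.comul (R := k) (δ k φ s u) =
    ∑ a : M, δ k φ a (φ (a⁻¹ * s) u) ⊗ₜ[k] δ k φ (a⁻¹ * s) u :=
  lift_δ _ _ _

theorem counit_δ (s : M) (u : G) : Coalgebra.counit (R := k) (δ k φ s u) =
    if s = 1 then 1 else 0 :=
  lift_δ _ _ _

instance : Coalgebra k (CrossCoproduct k φ) where
  coassoc := by
    refine hom_ext fun s u => ?_
    simp only [LinearMap.comp_apply, comul_δ, map_sum, LinearMap.rTensor_tmul,
      LinearMap.lTensor_tmul, TensorProduct.sum_tmul, TensorProduct.tmul_sum,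
      LinearEquiv.coe_coe, TensorProduct.assoc_tmul]
    rw [Finset.sum_comm]
    refine Finset.sum_congr rfl fun a _ => ?_
    refine Fintype.sum_equiv (Equiv.mulLeft a⁻¹) _ _ fun b => ?_
    simp [mul_assoc, map_mul]
  rTensor_counit_comp_comul := by
    refine hom_ext fun s u => ?_
    simp only [LinearMap.comp_apply, comul_δ, map_sum, LinearMap.rTensor_tmul, counit_δ]
    rw [Finset.sum_eq_single 1]
    · simp
    · intro a _ ha
      simp [ha]
    · simp
  lTensor_counit_comp_comul := by
    refine hom_ext fun s u => ?_
    simp only [LinearMap.comp_apply, comul_δ, map_sum, LinearMap.lTensor_tmul, counit_δ]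
    rw [Finset.sum_eq_single s]
    · simp
    · intro a _ ha
      have : a⁻¹ * s ≠ 1 := fun h => ha (inv_mul_eq_one.1 h)
      simp [this]
    · simp

instance : Bialgebra k (CrossCoproduct k φ) where
  counit_one := by
    rw [one_eq, map_sum]
    simp only [counit_δ]
    simp
  mul_compr₂_counit := by
    refine hom_ext fun s u => hom_ext fun t v => ?_
    simp only [LinearMap.compr₂_apply, LinearMap.compl₁₂_apply, LinearMap.mul_apply', δ_mul,
      counit_δ]
    by_cases hst : s = t
    · subst hst
      by_cases hs : s = 1 <;> simp [hs, counit_δ]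
    · by_cases hs : s = 1
      · have : t ≠ 1 := fun h => hst (hs.trans h.symm)
        simp [hst, this]
      · simp [hst, hs]
  comul_one := by
    simp only [one_eq, map_sum, comul_δ, map_one, Algebra.TensorProduct.one_def,
      TensorProduct.sum_tmul, TensorProduct.tmul_sum]
    rw [Finset.sum_comm]
    conv_rhs => rw [Finset.sum_comm]
    refine Finset.sum_congr rfl fun a _ => ?_
    exact Fintype.sum_equiv (Equiv.mulLeft a⁻¹) _ _ fun b => rfl
  mul_compr₂_comul := by
    refine hom_ext fun s u => hom_ext fun t v => ?_
    simp only [LinearMap.compr₂_apply, LinearMap.compl₁₂_apply, LinearMap.mul_apply', δ_mul,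
      comul_δ, Finset.sum_mul, Finset.mul_sum, Algebra.TensorProduct.tmul_mul_tmul]
    have key : ∀ a : M, (∑ b : M,
        ((if a = b then δ k φ a (φ (a⁻¹ * s) u * φ (b⁻¹ * t) v) else 0) ⊗ₜ[k]
          (if a⁻¹ * s = b⁻¹ * t then δ k φ (a⁻¹ * s) (u * v) else 0))) =
        if s = t then δ k φ a (φ (a⁻¹ * s) (u * v)) ⊗ₜ[k] δ k φ (a⁻¹ * s) (u * v) else 0 := by
      intro a
      rw [Finset.sum_eq_single a]
      · by_cases hst : s = t
        · subst hst
          simp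
        · simp [hst]
      · intro b _ hb
        simp [Ne.symm hb]
      · simp
    rw [Finset.sum_comm]
    simp only [key]
    by_cases hst : s = t
    · subst hst
      rw [if_pos rfl, comul_δ]
      simp
    · simp [hst]

/-- `S(δ_s ⊗ u) = δ_{s⁻¹} ⊗ (s▷u)⁻¹`. -/
instance : HopfAlgebra k (CrossCoproduct k φ) where
  antipode := lift k φ fun s u => δ k φ s⁻¹ (φ s u)⁻¹
  mul_antipode_rTensor_comul := by
    refine hom_ext fun s u => ?_
    simp only [LinearMap.comp_apply, comul_δ, map_sum, LinearMap.rTensor_tmul, lift_δ,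
      LinearMap.mul'_apply, δ_mul, counit_δ, Algebra.linearMap_apply]
    by_cases hs : s = 1
    · subst hs
      simp only [mul_one, if_true, map_one, one_eq]
      refine Fintype.sum_equiv (Equiv.inv M) _ _ fun a => ?_
      simp
    · have : ∀ a : M, a⁻¹ ≠ a⁻¹ * s := fun a h => hs (left_eq_mul.1 h)
      simp [hs, this]
  mul_antipode_lTensor_comul := by
    refine hom_ext fun s u => ?_
    simp only [LinearMap.comp_apply, comul_δ, map_sum, LinearMap.lTensor_tmul, lift_δ,
      LinearMap.mul'_apply, δ_mul, counit_δ, Algebra.linearMap_apply]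
    by_cases hs : s = 1
    · subst hs
      simp [one_eq]
    · simp [hs]

theorem antipode_δ (s : M) (u : G) : HopfAlgebra.antipode k (δ k φ s u) =
    δ k φ s⁻¹ (φ s u)⁻¹ :=
  lift_δ _ _ _

end CrossCoproduct

/-! ## The crossed module `kX` for `X = G ⋊ M` -/

section CrossedModule

open SemidirectProduct

variable {G M : Type*} [Group G] [Group M] {φ : M →* MulAut G}

/-- The action `s ▷ u` determined by the factorization `su = (s ▷ u)(s ◁ u)` in `X = GM`. -/
def actL (φ : M →* MulAut G) (s : M) (u : G) : G := (inr s * inl u : G ⋊[φ] M).left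

/-- The action `s ◁ u` determined by the factorization `su = (s ▷ u)(s ◁ u)` in `X = GM`. -/
def actR (φ : M →* MulAut G) (s : M) (u : G) : M := (inr s * inl u : G ⋊[φ] M).right

@[simp]
theorem actL_eq (s : M) (u : G) : actL φ s u = φ s u := by simp [actL]

@[simp]
theorem actR_eq (s : M) (u : G) : actR φ s u = s := by simp [actR]

/-- The `X`-degree `𝒩(vt) = ‖vt‖ = v⁻¹ t⁻¹ v`, a map `X → X`. -/
def degree (x : G ⋊[φ] M) : G ⋊[φ] M :=
  (inl x.left)⁻¹ * (inr x.right)⁻¹ * inl x.left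

/-- The right action of `X` on the set `X`:
`vt ◁~ us = (s' ▷ vu) (s' t s'⁻¹)` with `s' = s⁻¹ ◁ (vu)⁻¹`. -/
def crossAct (x y : G ⋊[φ] M) : G ⋊[φ] M :=
  let s' : M := actR φ y.right⁻¹ (x.left * y.left)⁻¹
  inl (actL φ s' (x.left * y.left)) * inr (s' * x.right * s'⁻¹)

theorem crossAct_one (x : G ⋊[φ] M) : crossAct x 1 = x := by
  ext <;> simp [crossAct]

theorem crossAct_mul (x y z : G ⋊[φ] M) :
    crossAct x (y * z) = crossAct (crossAct x y) z := by
  ext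
  · have h : ∀ (s : M) (u : G), φ s⁻¹ (φ s u) = u := fun s u => by
      rw [← MulAut.mul_apply, ← map_mul, inv_mul_cancel, map_one, MulAut.one_apply]
    simp only [crossAct, actL_eq, actR_eq, mul_left, mul_right, left_inl, left_inr, right_inl,
      right_inr, map_one, mul_one, one_mul, mul_inv_rev, map_mul, MulAut.mul_apply, h,
      MulAut.one_apply, mul_assoc]
  · simp [crossAct, mul_assoc]

/-- The crossed module condition `‖w ◁~ x‖ = x⁻¹ ‖w‖ x`. -/
theorem degree_crossAct (x y : G ⋊[φ] M) : degree (crossAct x y) = y⁻¹ * degree x * y := by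
  ext
  · simp [crossAct, degree, mul_assoc]
  · simp [crossAct, degree, mul_assoc]

variable (k : Type*) [Field k]

/-- The right action of `y ∈ X` on the vector space `kX` with basis `X`. -/
def linAct (y : G ⋊[φ] M) : ((G ⋊[φ] M) →₀ k) →ₗ[k] ((G ⋊[φ] M) →₀ k) :=
  Finsupp.lmapDomain k k fun x => crossAct x y

/-- `J_z = k 𝒩⁻¹(z)`, as a subspace of `kX`. -/
def fibreSpace (z : G ⋊[φ] M) : Submodule k ((G ⋊[φ] M) →₀ k) :=
  Finsupp.supported k k (degree ⁻¹' {z})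

/-- `N_0 = {u ∈ G | t_0 ▷ u = u}`. -/
def fixSubgroup (φ : M →* MulAut G) (t₀ : M) : Subgroup G where
  carrier := {u | φ t₀ u = u}
  mul_mem' := by
    intro a b ha hb
    change φ t₀ (a * b) = a * b
    rw [map_mul, show φ t₀ a = a from ha, show φ t₀ b = b from hb]
  one_mem' := map_one (φ t₀)
  inv_mem' := by
    intro a ha
    change φ t₀ a⁻¹ = a⁻¹
    rw [map_inv, show φ t₀ a = a from ha]

variable [Fintype G] [DecidableEq G] [Fintype M] [DecidableEq M]

/-- `m_0 = ∑_{v ∈ N_0} v t_0 ∈ kX`. -/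
def m₀ (φ : M →* MulAut G) (t₀ : M) : (G ⋊[φ] M) →₀ k :=
  ∑ v : G with φ t₀ v = v, Finsupp.single (inl v * inr t₀) 1

/-- The subspace `𝓜` of `kX` spanned by the translates `m_0 ◁~ x` with `x ∈ X`. -/
def translates (φ : M →* MulAut G) (t₀ : M) : Submodule k ((G ⋊[φ] M) →₀ k) :=
  Submodule.span k (Set.range fun x : G ⋊[φ] M => linAct k x (m₀ k φ t₀))

/-- `Π : kX → H⁺ ⊆ H = A*`, `vt ↦ t ⊗ δ_v - ε(t ⊗ δ_v) 1`, where `ε(t ⊗ δ_v) = δ_{v,e}` and the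
unit of `H` is the counit of `A`. -/
def proj (φ : M →* MulAut G) :
    ((G ⋊[φ] M) →₀ k) →ₗ[k] Module.Dual k (CrossCoproduct k φ) :=
  Finsupp.linearCombination k fun x : G ⋊[φ] M =>
    CrossCoproduct.coord k φ x.right x.left -
      (if x.left = 1 then (1 : k) else 0) • Coalgebra.counit (R := k) (A := CrossCoproduct k φ)

end CrossedModule

end NCCalc

end

open NCCalc
open SemidirectProduct (inl inr)

universe w uk uG uM

namespace NCCalc

/-! ### Conjugacy classes, degree fibres and centralizers in `G ⋊[φ] M`. -/

section Group

variable {G M : Type*} [Group G] [Group M] {φ : M →* MulAut G}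

/-! The action `◁~` permutes the basis `X` of `kX`, and by `degree_crossAct` it conjugates degrees.
The element `m₀` is the indicator function of the fibre over `t₀⁻¹` (`m₀_eq`), so `y` carries it to
the indicator of the fibre over `y⁻¹ t₀⁻¹ y` (`linAct_m₀`). These indicators have disjoint nonempty
supports, so they form a basis of `𝓜` indexed by the conjugacy class. Triviality under the
centralizer and independence of the representative follow at once.

For `t₀ ≠ e` the calculus is written down: the free left `A`-module on forms `e_x` (`invForm`), with
`x` in the class of `t₀` in `X`. Right multiplication conjugates the index by `G`, the right
coaction by `M`. The sum `θ` of the `e_x` with `x ∈ M` is biinvariant, so `d a = θ a - a θ` is a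
bicomodule map obeying Leibniz. One finds `ϖ a = ∑_x ⟨tangentVector x, a⟩ e_x`
(`formProj_comp_diff`), and `tangentVector x` is the image under `Π` of the indicator over `x⁻¹`
(`proj_fibreSum`); hence the tangent space is `Π(𝓜)`. A nonzero sub-bimodule and sub-bicomodule
contains a basis vector, hence all of them, since `X` is transitive on the class. For `t₀ = e` the
only tangent vector is zero.

Uniqueness holds over any Hopf algebra: `a db = a b₁ ϖ(b₂)`, and the left coaction recovers `a b₁ ⊗
ϖ(b₂)` from this form. So the kernel of `a ⊗ b ↦ a db` depends only on `ker ϖ` (`ker_mulD`), and the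
tangent space is the annihilator of `ker ϖ`. -/

theorem mk_eq_inl_mul_inr (x : G ⋊[φ] M) : inl x.left * inr x.right = x :=
  SemidirectProduct.inl_left_mul_inr_right x

/-- Split the conjugating element as `u s`: conjugation by `s` stays in `M`, and only `u ∈ G` leaves
it. -/
theorem isConj_inr_iff {t₀ : M} {x : G ⋊[φ] M} :
    IsConj (inr t₀) x ↔ ∃ t, IsConj t₀ t ∧ ∃ u : G, x = (inl u)⁻¹ * inr t * inl u := by
  constructor
  · intro h
    obtain ⟨c, rfl⟩ := isConj_iff.1 h
    obtain ⟨u, s, rfl⟩ : ∃ u s, c = inl u * inr s := ⟨_, _, (mk_eq_inl_mul_inr c).symm⟩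
    exact ⟨s * t₀ * s⁻¹, isConj_iff.2 ⟨_, rfl⟩, u⁻¹, by simp [mul_assoc]⟩
  · rintro ⟨t, ht, u, rfl⟩
    obtain ⟨c, rfl⟩ := isConj_iff.1 ht
    refine isConj_iff.2 ⟨(inl u)⁻¹ * inr c, ?_⟩
    simp [mul_assoc]

theorem inl_inv_mul_inr_mul_inl (t : M) (u : G) :
    ((inl u)⁻¹ * inr t * inl u : G ⋊[φ] M) = inl (u⁻¹ * φ t u) * inr t := by
  ext <;> simp

theorem conjugatesOf_inr (t₀ : M) :
    conjugatesOf (inr t₀ : G ⋊[φ] M) =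
      {x | ∃ t ∈ conjugatesOf t₀, ∃ u : G, x = inl (u⁻¹ * φ t u) * inr t} := by
  ext x
  simp only [← inl_inv_mul_inr_mul_inl]
  exact isConj_inr_iff

theorem mem_fixSubgroup {t : M} {u : G} : u ∈ fixSubgroup φ t ↔ φ t u = u := Iff.rfl

/-- For `x = vt` the equation reads `t v = v t₀`; comparison with `t v = (t ▷ v) t` gives both
components. -/
theorem degree_eq_inr_inv_iff {t₀ : M} {x : G ⋊[φ] M} :
    degree x = inr t₀⁻¹ ↔ φ t₀ x.left = x.left ∧ x.right = t₀ := by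
  have h : degree x = inr t₀⁻¹ ↔ inr x.right * inl x.left = (inl x.left * inr t₀ : G ⋊[φ] M) := by
    rw [degree, map_inv, mul_assoc, inv_mul_eq_iff_eq_mul, inv_mul_eq_iff_eq_mul,
      ← mul_assoc, eq_mul_inv_iff_mul_eq, eq_comm]
  rw [h, SemidirectProduct.ext_iff]
  simp only [SemidirectProduct.mul_left, SemidirectProduct.mul_right,
    SemidirectProduct.left_inl, SemidirectProduct.left_inr, SemidirectProduct.right_inl,
    SemidirectProduct.right_inr, map_one, mul_one, one_mul]
  constructor
  · rintro ⟨h1, h2⟩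
    exact ⟨h2 ▸ h1, h2⟩
  · rintro ⟨h1, h2⟩
    exact ⟨h2 ▸ h1, h2⟩

theorem preimage_degree (t₀ : M) : degree ⁻¹' {(inr t₀⁻¹ : G ⋊[φ] M)} =
    {x | ∃ u ∈ fixSubgroup φ t₀, x = inl u * inr t₀} := by
  ext x
  simp only [Set.mem_preimage, Set.mem_singleton_iff, degree_eq_inr_inv_iff, Set.mem_ofPred_eq]
  constructor
  · rintro ⟨h1, h2⟩
    exact ⟨x.left, h1, by rw [← h2, mk_eq_inl_mul_inr]⟩
  · rintro ⟨u, hu, rfl⟩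
    simpa using mem_fixSubgroup.1 hu

theorem centralizer_inr (t₀ : M) :
    (Subgroup.centralizer {(inr t₀ : G ⋊[φ] M)} : Set (G ⋊[φ] M)) =
      {x | ∃ u ∈ fixSubgroup φ t₀, ∃ s ∈ Subgroup.centralizer {t₀}, x = inl u * inr s} := by
  ext x
  simp only [SetLike.mem_coe, Subgroup.mem_centralizer_singleton_iff, Set.mem_ofPred_eq]
  constructor
  · intro h
    have h1 := congrArg SemidirectProduct.left h
    have h2 := congrArg SemidirectProduct.right h
    simp at h1 h2
    exact ⟨x.left, h1.symm, x.right, h2, (mk_eq_inl_mul_inr x).symm⟩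
  · rintro ⟨u, hu, s, hs, rfl⟩
    rw [mem_fixSubgroup] at hu
    ext
    · simp [hu]
    · simpa using hs

theorem crossAct_bijective (y : G ⋊[φ] M) : Function.Bijective fun x : G ⋊[φ] M => crossAct x y :=
  Function.bijective_iff_has_inverse.2 ⟨fun x => crossAct x y⁻¹,
    fun x => by simp [← crossAct_mul, crossAct_one], fun x => by simp [← crossAct_mul, crossAct_one]⟩

/-- Nonempty fibres keep the indicator functions nonzero, hence independent. -/
theorem exists_degree_eq_of_isConj {t₀ : M} {z : G ⋊[φ] M} (h : IsConj (inr t₀⁻¹) z) :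
    ∃ x, degree x = z := by
  obtain ⟨t, _, u, rfl⟩ := isConj_inr_iff.1 h
  exact ⟨inl u * inr t⁻¹, by simp [degree]⟩

/-- Needed because `𝓜` is indexed by the class of `t₀⁻¹` and the forms by that of `t₀`. -/
theorem conjugatesOf_inr_inv (t₀ : M) : conjugatesOf (inr t₀⁻¹ : G ⋊[φ] M) =
    (fun x => x⁻¹) '' conjugatesOf (inr t₀) := by
  ext z
  simp only [conjugatesOf, Set.mem_image, Set.mem_ofPred_eq, isConj_iff]
  constructor
  · rintro ⟨c, rfl⟩
    exact ⟨_, ⟨c, rfl⟩, by simp [mul_assoc]⟩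
  · rintro ⟨_, ⟨c, rfl⟩, rfl⟩
    exact ⟨c, by simp [mul_assoc]⟩

theorem inv_mul_inr_inv_mul {t₀ : M} {x : G ⋊[φ] M}
    (hx : x ∈ Subgroup.centralizer {(inr t₀ : G ⋊[φ] M)}) :
    x⁻¹ * inr t₀⁻¹ * x = inr t₀⁻¹ := by
  rw [Subgroup.mem_centralizer_singleton_iff] at hx
  have := Commute.inv_right (show Commute x (inr t₀) from hx)
  rw [map_inv, mul_assoc, ← this.eq, inv_mul_cancel_left]

end Group

/-! ### Indicator functions of the degree fibres, and the space `𝓜`. -/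

section Indicator

variable (k : Type*) [Field k] {G M : Type*} [Group G] [Group M] {φ : M →* MulAut G}
theorem map_linAct_fibreSpace (z x : G ⋊[φ] M) :
    (fibreSpace k z).map (linAct k x) ≤ fibreSpace k (x⁻¹ * z * x) := by
  rw [linAct, fibreSpace, Finsupp.lmapDomain_supported]
  refine Finsupp.supported_mono ?_
  rintro _ ⟨y, hy, rfl⟩
  rw [Set.mem_preimage, Set.mem_singleton_iff] at hy ⊢
  rw [degree_crossAct, hy]

variable [Fintype G] [Fintype M]

instance : Finite (G ⋊[φ] M) :=
  Finite.of_equiv _ SemidirectProduct.equivProd.symm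

/-- The indicator function of the fibre of the degree map over `z`. -/
noncomputable def fibreSum (z : G ⋊[φ] M) : (G ⋊[φ] M) →₀ k :=
  Finsupp.equivFunOnFinite.symm ((degree ⁻¹' {z}).indicator 1)

theorem fibreSum_apply (z x : G ⋊[φ] M) [Decidable (degree x = z)] :
    fibreSum k z x = if degree x = z then 1 else 0 := by
  classical
  simp only [fibreSum, Finsupp.equivFunOnFinite_symm_apply_apply, Set.indicator_apply,
    Set.mem_preimage, Set.mem_singleton_iff, Pi.one_apply]

/-- A permutation of `X` carries indicators to indicators, and `degree_crossAct` identifies the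
image of the fibre. -/
theorem linAct_fibreSum (y z : G ⋊[φ] M) :
    linAct k y (fibreSum k z) = fibreSum k (y⁻¹ * z * y) := by
  classical
  ext w
  obtain ⟨x, rfl⟩ := (crossAct_bijective y).2 w
  have h : linAct k y (fibreSum k z) (crossAct x y) = fibreSum k z x :=
    Finsupp.mapDomain_apply (crossAct_bijective y).1 _ x
  rw [h, fibreSum_apply, fibreSum_apply]
  refine if_congr ?_ rfl rfl
  rw [degree_crossAct, mul_left_inj, mul_right_inj]

theorem fibreSum_mem_fibreSpace (z : G ⋊[φ] M) : fibreSum k z ∈ fibreSpace k z := by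
  classical
  rw [fibreSpace, Finsupp.mem_supported]
  intro x hx
  by_contra h
  exact Finsupp.mem_support_iff.1 hx (by rw [fibreSum_apply]; exact if_neg h)

/-- The supports are disjoint: evaluation at a point `p i` of the `i`-th fibre isolates the `i`-th
coefficient. -/
theorem linearIndependent_fibreSum {ι : Type*} (z : ι → G ⋊[φ] M) (hz : Function.Injective z)
    (hd : ∀ i, ∃ x, degree x = z i) : LinearIndependent k fun i => fibreSum k (z i) := by
  classical
  choose p hp using hd
  rw [linearIndependent_iff']
  intro s c hc i hi
  have h := DFunLike.congr_fun hc (p i)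
  simp only [Finsupp.coe_finsetSum, Finset.sum_apply, Finsupp.smul_apply, fibreSum_apply, hp,
    hz.eq_iff, smul_eq_mul, mul_ite, mul_one, mul_zero, Finsupp.zero_apply] at h
  simpa [hi] using h

variable [DecidableEq G] [DecidableEq M]

theorem m₀_eq (t₀ : M) : m₀ k φ t₀ = fibreSum k (inr t₀⁻¹) := by
  ext x
  rw [fibreSum_apply, m₀, if_congr degree_eq_inr_inv_iff rfl rfl]
  simp only [Finsupp.coe_finsetSum, Finset.sum_apply,
    Finsupp.single_apply, SemidirectProduct.ext_iff]
  simp only [SemidirectProduct.mul_left, SemidirectProduct.mul_right,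
    SemidirectProduct.left_inl, SemidirectProduct.left_inr, SemidirectProduct.right_inl,
    SemidirectProduct.right_inr, map_one, mul_one, one_mul]
  rw [← Finset.sum_filter, Finset.filter_filter]
  by_cases h : φ t₀ x.left = x.left ∧ x.right = t₀
  · rw [if_pos h, Finset.sum_eq_card_nsmul (b := 1) (by simp),
      Finset.card_eq_one.2 ⟨x.left, ?_⟩, one_smul]
    ext v
    simp only [Finset.mem_filter, Finset.mem_univ, true_and, Finset.mem_singleton]
    constructor
    · exact fun hv => hv.2.1
    · rintro rfl
      exact ⟨h.1, rfl, h.2.symm⟩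
  · rw [if_neg h]
    refine Finset.sum_eq_zero fun v hv => absurd ?_ h
    simp only [Finset.mem_filter, Finset.mem_univ, true_and] at hv
    exact ⟨hv.2.1 ▸ hv.1, hv.2.2.symm⟩

theorem linAct_m₀ (t₀ : M) (y : G ⋊[φ] M) :
    linAct k y (m₀ k φ t₀) = fibreSum k (y⁻¹ * inr t₀⁻¹ * y) := by
  rw [m₀_eq, linAct_fibreSum]

theorem translates_eq (t₀ : M) : translates k φ t₀ =
    Submodule.span k (fibreSum k '' conjugatesOf (inr t₀⁻¹)) := by
  rw [translates]
  congr 1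
  ext m
  simp only [Set.mem_range, Set.mem_image, linAct_m₀]
  constructor
  · rintro ⟨y, rfl⟩
    exact ⟨_, isConj_iff.2 ⟨y⁻¹, rfl⟩, by simp⟩
  · rintro ⟨_, hc, rfl⟩
    obtain ⟨c, rfl⟩ := isConj_iff.1 hc
    exact ⟨c⁻¹, by simp⟩

theorem translates_eq_of_isConj {t₀ t₁ : M} (h : IsConj t₀ t₁) :
    translates k φ t₁ = translates k φ t₀ := by
  have h' : IsConj (inr t₁⁻¹ : G ⋊[φ] M) (inr t₀⁻¹) := by
    obtain ⟨c, rfl⟩ := isConj_iff.1 h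
    exact isConj_iff.2 ⟨inr c⁻¹, by simp [mul_assoc]⟩
  rw [translates_eq, translates_eq, h'.conjugatesOf_eq]

theorem linearIndependent_linAct_m₀ (t₀ : M)
    (zbar : (conjugatesOf (inr t₀⁻¹ : G ⋊[φ] M)) → G ⋊[φ] M)
    (h : ∀ z, (zbar z)⁻¹ * inr t₀⁻¹ * zbar z = (z : G ⋊[φ] M)) :
    LinearIndependent k (fun z => linAct k (zbar z) (m₀ k φ t₀)) := by
  simp only [linAct_m₀, h]
  exact linearIndependent_fibreSum k _ Subtype.val_injective
    fun z => exists_degree_eq_of_isConj z.2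

theorem span_linAct_m₀ (t₀ : M)
    (zbar : (conjugatesOf (inr t₀⁻¹ : G ⋊[φ] M)) → G ⋊[φ] M)
    (h : ∀ z, (zbar z)⁻¹ * inr t₀⁻¹ * zbar z = (z : G ⋊[φ] M)) :
    Submodule.span k (Set.range fun z => linAct k (zbar z) (m₀ k φ t₀)) =
      translates k φ t₀ := by
  simp only [linAct_m₀, h, translates_eq]
  rw [Set.image_eq_range]

theorem m₀_ne_zero (t₀ : M) : m₀ k φ t₀ ≠ 0 := by
  intro h
  have := DFunLike.congr_fun h (inr t₀)
  rw [m₀_eq, fibreSum_apply, if_pos (by simp [degree])] at this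
  exact one_ne_zero this

theorem linAct_m₀_of_mem_centralizer {t₀ : M} {x : G ⋊[φ] M}
    (hx : x ∈ Subgroup.centralizer {(inr t₀ : G ⋊[φ] M)}) :
    linAct k x (m₀ k φ t₀) = m₀ k φ t₀ := by
  rw [linAct_m₀, m₀_eq, inv_mul_inr_inv_mul hx]

end Indicator

end NCCalc

namespace NCCalc

noncomputable section

/-! ### The bimodule and bicomodule of forms attached to a conjugacy class. -/

namespace ClassCalculus

open CrossCoproduct

section Conj

variable {G M : Type*} [Group G] [Group M] {φ : M →* MulAut G} {t₀ : M}

/-- Conjugation by `y ∈ X` on the conjugacy class of `t₀` in `X = G ⋊ M`. -/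
def conjBy (y : G ⋊[φ] M) (x : conjugatesOf (inr t₀ : G ⋊[φ] M)) :
    conjugatesOf (inr t₀ : G ⋊[φ] M) :=
  ⟨y * x * y⁻¹, IsConj.trans x.2 (isConj_iff.2 ⟨y, rfl⟩)⟩

variable (y z : G ⋊[φ] M) (u : G) (b : M) (x : conjugatesOf (inr t₀ : G ⋊[φ] M))

theorem conjBy_conjBy : conjBy y (conjBy z x) = conjBy (y * z) x :=
  Subtype.ext (by simp [conjBy, mul_assoc])

@[simp]
theorem conjBy_one : conjBy 1 x = x :=
  Subtype.ext (by simp [conjBy])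

@[simp]
theorem conjBy_inl_right : (conjBy (inl u) x).1.right = x.1.right := by simp [conjBy]

@[simp]
theorem conjBy_inl_left : (conjBy (inl u) x).1.left = u * x.1.left * φ x.1.right u⁻¹ := by
  simp [conjBy]

@[simp]
theorem conjBy_inr_right : (conjBy (inr b) x).1.right = b * x.1.right * b⁻¹ := by
  simp [conjBy]

@[simp]
theorem conjBy_inr_left : (conjBy (inr b) x).1.left = φ b x.1.left := by
  simp [conjBy]

/-- This is `b u = (b ▷ u) b` in `X`; it reconciles the right coaction with right multiplication. -/
theorem conjBy_inr_inl :
    conjBy (inr b) (conjBy (inl u) x) = conjBy (inl (φ b u)) (conjBy (inr b) x) := by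
  rw [conjBy_conjBy, conjBy_conjBy]
  congr 1
  ext <;> simp

/-- Conjugation by `y` as a permutation of the conjugacy class. -/
def conjEquiv : conjugatesOf (inr t₀ : G ⋊[φ] M) ≃ conjugatesOf (inr t₀ : G ⋊[φ] M) where
  toFun := conjBy y
  invFun := conjBy y⁻¹
  left_inv x := by simp [conjBy_conjBy]
  right_inv x := by simp [conjBy_conjBy]

theorem isConj_right : IsConj t₀ x.1.right := by
  obtain ⟨c, hc⟩ := isConj_iff.1 x.2
  refine isConj_iff.2 ⟨c.right, ?_⟩
  rw [← hc]
  simp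

/-- Reduces questions about the class to its elements in `M`, where `θ` is supported. -/
theorem exists_eq_conjBy (x : conjugatesOf (inr t₀ : G ⋊[φ] M)) :
    ∃ (u : G) (y : conjugatesOf (inr t₀ : G ⋊[φ] M)), y.1.left = 1 ∧ x = conjBy (inl u) y := by
  obtain ⟨x, hx⟩ := x
  obtain ⟨t, ht, u, rfl⟩ := isConj_inr_iff.1 hx
  refine ⟨u⁻¹, ⟨inr t, isConj_inr_iff.2 ⟨t, ht, 1, by simp⟩⟩, by simp, ?_⟩
  exact Subtype.ext (by simp [conjBy])

end Conj

variable (k : Type*) [Field k] {G M : Type*} [Group G] [Group M] (φ : M →* MulAut G) (t₀ : M)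

/-- The space of 1-forms: its basis is indexed by `M × G` (a basis of the functions) and the
conjugacy class of `t₀` in `X` (a basis of the left-invariant forms). -/
abbrev Form : Type _ := (M × G × conjugatesOf (inr t₀ : G ⋊[φ] M)) →₀ k

variable {φ t₀}

/-- The basis vectors of the space of 1-forms. -/
def form (m : M) (g : G) (x : conjugatesOf (inr t₀ : G ⋊[φ] M)) : Form k φ t₀ :=
  Finsupp.single (m, g, x) 1

variable {k}

theorem form_hom_ext {W : Type*} [AddCommMonoid W] [Module k W] {f f' : Form k φ t₀ →ₗ[k] W}
    (h : ∀ m g x, f (form k m g x) = f' (form k m g x)) : f = f' :=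
  Finsupp.lhom_ext' fun i => LinearMap.ext_ring (h i.1 i.2.1 i.2.2)

variable (k) in
/-- The linear map with prescribed values on the basis vectors. -/
def formLift {W : Type*} [AddCommMonoid W] [Module k W]
    (f : M → G → conjugatesOf (inr t₀ : G ⋊[φ] M) → W) : Form k φ t₀ →ₗ[k] W :=
  Finsupp.linearCombination k fun i => f i.1 i.2.1 i.2.2

@[simp]
theorem formLift_form {W : Type*} [AddCommMonoid W] [Module k W]
    (f : M → G → conjugatesOf (inr t₀ : G ⋊[φ] M) → W) (m : M) (g : G)
    (x : conjugatesOf (inr t₀ : G ⋊[φ] M)) : formLift k f (form k m g x) = f m g x := by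
  simp [formLift, form]

variable [Fintype G] [DecidableEq G] [Fintype M] [DecidableEq M]

variable (k φ t₀) in
/-- Left multiplication of forms. -/
def leftMul : CrossCoproduct k φ →ₗ[k] Module.End k (Form k φ t₀) :=
  lift k φ fun s u => formLift k fun m g x => if s = m then form k m (u * g) x else 0

variable (k φ t₀) in
/-- Right multiplication of forms. -/
def rightMul : CrossCoproduct k φ →ₗ[k] Module.End k (Form k φ t₀) :=
  -- With `form k m g x = (δ_m ⊗ g) e_x` and `t = x.1.right`, this encodes `e_x (δ_s ⊗ u) = (δ_{s
  -- t⁻¹} ⊗ t ▷ u) e_{u⁻¹ x u}`.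
  lift k φ fun s u => formLift k fun m g x =>
    if m * x.1.right = s then form k m (g * φ x.1.right u) (conjBy (inl u⁻¹) x) else 0

theorem leftMul_δ (s : M) (u : G) (m : M) (g : G) (x : conjugatesOf (inr t₀ : G ⋊[φ] M)) :
    leftMul k φ t₀ (δ k φ s u) (form k m g x) = if s = m then form k m (u * g) x else 0 := by
  simp [leftMul]

theorem rightMul_δ (s : M) (u : G) (m : M) (g : G) (x : conjugatesOf (inr t₀ : G ⋊[φ] M)) :
    rightMul k φ t₀ (δ k φ s u) (form k m g x) = if m * x.1.right = s then
      form k m (g * φ x.1.right u) (conjBy (inl u⁻¹) x) else 0 := by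
  simp [rightMul]

variable (k φ t₀) in
/-- The left action as an algebra map. -/
def leftAct : CrossCoproduct k φ →ₐ[k] Module.End k (Form k φ t₀) :=
  AlgHom.ofLinearMap (leftMul k φ t₀)
    (form_hom_ext fun m g x => by simp [one_eq, map_sum, LinearMap.sum_apply, leftMul_δ])
    (LinearMap.ext_iff₂.1 <| show (LinearMap.mul k _).compr₂ (leftMul k φ t₀) =
        (LinearMap.mul k _).compl₁₂ (leftMul k φ t₀) (leftMul k φ t₀) from
      hom_ext fun s u => hom_ext fun t v => form_hom_ext fun m g x => by
        simp only [LinearMap.compr₂_apply, LinearMap.compl₁₂_apply, LinearMap.mul_apply', δ_mul,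
          Module.End.mul_apply, leftMul_δ]
        by_cases hst : s = t <;> by_cases htm : t = m <;>
          simp_all [leftMul_δ, mul_assoc])

variable (k φ t₀) in
/-- The right action as an algebra map. -/
def rightAct : (CrossCoproduct k φ)ᵐᵒᵖ →ₐ[k] Module.End k (Form k φ t₀) :=
  AlgHom.ofLinearMap
    (rightMul k φ t₀ ∘ₗ (MulOpposite.opLinearEquiv k : CrossCoproduct k φ ≃ₗ[k] _).symm)
    (form_hom_ext fun m g x => by
      simp [one_eq, map_sum, LinearMap.sum_apply, rightMul_δ])
    (fun a b => LinearMap.ext_iff₂.1 (show (LinearMap.mul k _).compr₂ (rightMul k φ t₀) =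
        (LinearMap.mul k _).flip.compl₁₂ (rightMul k φ t₀) (rightMul k φ t₀) from
      hom_ext fun s u => hom_ext fun t v => form_hom_ext fun m g x => by
        simp only [LinearMap.compr₂_apply, LinearMap.compl₁₂_apply, LinearMap.mul_apply', δ_mul,
          Module.End.mul_apply, rightMul_δ, LinearMap.flip_apply]
        by_cases hst : s = t <;> by_cases hs : m * x.1.right = s <;>
          simp_all [rightMul_δ, mul_assoc, conjBy_conjBy, -map_inv]) b.unop a.unop)

theorem leftMul_rightMul (a b : CrossCoproduct k φ) (ω : Form k φ t₀) :
    leftMul k φ t₀ a (rightMul k φ t₀ b ω) = rightMul k φ t₀ b (leftMul k φ t₀ a ω) := by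
  refine LinearMap.congr_fun (LinearMap.ext_iff₂.1 (show
    (LinearMap.mul k _).compl₁₂ (leftMul k φ t₀) (rightMul k φ t₀) =
    (LinearMap.mul k _).flip.compl₁₂ (leftMul k φ t₀) (rightMul k φ t₀) from
      hom_ext fun s u => hom_ext fun t v => form_hom_ext fun m g x => ?_) a b) ω
  simp only [LinearMap.compl₁₂_apply, LinearMap.mul_apply',
    Module.End.mul_apply, rightMul_δ, LinearMap.flip_apply, leftMul_δ]
  by_cases hs : s = m <;> by_cases ht : m * x.1.right = t <;>
    simp [hs, ht, rightMul_δ, leftMul_δ, mul_assoc]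

variable (k φ t₀) in
/-- The left coaction. -/
def leftCoact : Form k φ t₀ →ₗ[k] CrossCoproduct k φ ⊗[k] Form k φ t₀ :=
  -- The coproduct acts on the `A`-factor alone, which makes each `e_x` left-invariant.
  formLift k fun m g x => ∑ b : M, δ k φ (m * b⁻¹) (φ b g) ⊗ₜ[k] form k b g x

variable (k φ t₀) in
/-- The right coaction. -/
def rightCoact : Form k φ t₀ →ₗ[k] Form k φ t₀ ⊗[k] CrossCoproduct k φ :=
  -- This is `Δ(δ_m ⊗ g)` times `e_x ↦ ∑_b e_{b x b⁻¹} ⊗ (δ_b ⊗ v⁻¹)`, where `v = x.1.left`.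
  formLift k fun m g x => ∑ b : M,
    form k (m * b⁻¹) (φ b g) (conjBy (inr b) x) ⊗ₜ[k] δ k φ b (g * x.1.left⁻¹)

omit [Fintype G] [DecidableEq G] in
theorem leftCoact_form (m : M) (g : G) (x : conjugatesOf (inr t₀ : G ⋊[φ] M)) :
    leftCoact k φ t₀ (form k m g x) =
      ∑ b : M, δ k φ (m * b⁻¹) (φ b g) ⊗ₜ[k] form k b g x :=
  formLift_form _ _ _ _

omit [Fintype G] [DecidableEq G] in
theorem rightCoact_form (m : M) (g : G) (x : conjugatesOf (inr t₀ : G ⋊[φ] M)) :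
    rightCoact k φ t₀ (form k m g x) = ∑ b : M,
      form k (m * b⁻¹) (φ b g) (conjBy (inr b) x) ⊗ₜ[k] δ k φ b (g * x.1.left⁻¹) :=
  formLift_form _ _ _ _

/-- The coproduct, summed over the second tensor factor. -/
theorem comul_δ' (s : M) (u : G) : Coalgebra.comul (R := k) (δ k φ s u) =
    ∑ b : M, δ k φ (s * b⁻¹) (φ b u) ⊗ₜ[k] δ k φ b u := by
  rw [comul_δ]
  exact Fintype.sum_equiv ((Equiv.inv M).trans (Equiv.mulRight s)) _ _ fun a => by simp

theorem leftCoact_counit (ω : Form k φ t₀) :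
    TensorProduct.lid k _ ((Coalgebra.counit (R := k)).rTensor _ (leftCoact k φ t₀ ω)) = ω := by
  refine LinearMap.congr_fun (f := (TensorProduct.lid k _).toLinearMap ∘ₗ
    (Coalgebra.counit (R := k)).rTensor _ ∘ₗ leftCoact k φ t₀) (g := LinearMap.id)
    (form_hom_ext fun m g x => ?_) ω
  simp only [LinearMap.comp_apply, leftCoact_form, map_sum, LinearMap.rTensor_tmul, counit_δ,
    mul_inv_eq_one]
  simp [TensorProduct.lid_tmul]

theorem rightCoact_counit (ω : Form k φ t₀) :
    TensorProduct.rid k _ ((Coalgebra.counit (R := k)).lTensor _ (rightCoact k φ t₀ ω)) = ω := by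
  refine LinearMap.congr_fun (f := (TensorProduct.rid k _).toLinearMap ∘ₗ
    (Coalgebra.counit (R := k)).lTensor _ ∘ₗ rightCoact k φ t₀) (g := LinearMap.id)
    (form_hom_ext fun m g x => ?_) ω
  simp only [LinearMap.comp_apply, rightCoact_form, map_sum, LinearMap.lTensor_tmul, counit_δ]
  simp [TensorProduct.rid_tmul]

theorem leftCoact_coassoc (ω : Form k φ t₀) : TensorProduct.assoc k _ _ _
    ((Coalgebra.comul (R := k)).rTensor _ (leftCoact k φ t₀ ω)) =
      (leftCoact k φ t₀).lTensor _ (leftCoact k φ t₀ ω) := by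
  refine LinearMap.congr_fun (f := (TensorProduct.assoc k _ _ _).toLinearMap ∘ₗ
    (Coalgebra.comul (R := k)).rTensor _ ∘ₗ leftCoact k φ t₀)
    (g := (leftCoact k φ t₀).lTensor _ ∘ₗ leftCoact k φ t₀)
    (form_hom_ext fun m g x => ?_) ω
  simp only [LinearMap.comp_apply, leftCoact_form, map_sum, LinearMap.rTensor_tmul, comul_δ',
    LinearMap.lTensor_tmul, TensorProduct.sum_tmul, TensorProduct.tmul_sum,
    LinearEquiv.coe_coe, TensorProduct.assoc_tmul]
  rw [Finset.sum_comm]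
  conv_rhs => rw [Finset.sum_comm]
  rw [Finset.sum_comm]
  refine Finset.sum_congr rfl fun b _ => ?_
  exact Fintype.sum_equiv (Equiv.mulRight b) _ _ fun c => by simp [mul_assoc]

theorem rightCoact_coassoc (ω : Form k φ t₀) : TensorProduct.assoc k _ _ _
    ((rightCoact k φ t₀).rTensor _ (rightCoact k φ t₀ ω)) =
      (Coalgebra.comul (R := k)).lTensor _ (rightCoact k φ t₀ ω) := by
  refine LinearMap.congr_fun (f := (TensorProduct.assoc k _ _ _).toLinearMap ∘ₗ
    (rightCoact k φ t₀).rTensor _ ∘ₗ rightCoact k φ t₀)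
    (g := (Coalgebra.comul (R := k)).lTensor _ ∘ₗ rightCoact k φ t₀)
    (form_hom_ext fun m g x => ?_) ω
  simp only [LinearMap.comp_apply, rightCoact_form, map_sum, LinearMap.rTensor_tmul, comul_δ',
    LinearMap.lTensor_tmul, TensorProduct.sum_tmul, TensorProduct.tmul_sum,
    LinearEquiv.coe_coe, TensorProduct.assoc_tmul]
  conv_rhs => rw [Finset.sum_comm]
  refine Finset.sum_congr rfl fun b _ => ?_
  refine Fintype.sum_equiv (Equiv.mulRight b) _ _ fun c => ?_
  simp [mul_assoc, conjBy_conjBy]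

omit [Fintype G] [DecidableEq G] in
theorem leftCoact_rightCoact (ω : Form k φ t₀) : TensorProduct.assoc k _ _ _
    ((leftCoact k φ t₀).rTensor _ (rightCoact k φ t₀ ω)) =
      (rightCoact k φ t₀).lTensor _ (leftCoact k φ t₀ ω) := by
  refine LinearMap.congr_fun (f := (TensorProduct.assoc k _ _ _).toLinearMap ∘ₗ
    (leftCoact k φ t₀).rTensor _ ∘ₗ rightCoact k φ t₀)
    (g := (rightCoact k φ t₀).lTensor _ ∘ₗ leftCoact k φ t₀)
    (form_hom_ext fun m g x => ?_) ω
  simp only [LinearMap.comp_apply, rightCoact_form, map_sum, LinearMap.rTensor_tmul,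
    leftCoact_form, LinearMap.lTensor_tmul, TensorProduct.sum_tmul, TensorProduct.tmul_sum,
    LinearEquiv.coe_coe, TensorProduct.assoc_tmul]
  conv_rhs => rw [Finset.sum_comm]
  refine Finset.sum_congr rfl fun b _ => ?_
  refine Fintype.sum_equiv (Equiv.mulRight b) _ _ fun c => ?_
  simp [mul_assoc]

end ClassCalculus

end

end NCCalc

/-! ### The coactions are bimodule maps. -/

namespace NCCalc

noncomputable section

/-- Against a pure tensor, such as `1 ⊗ θ`, `map₂` becomes an ordinary `map`. -/
theorem map₂_tmul_right {R P P' Q Q' S T : Type*} [CommSemiring R] [AddCommMonoid P]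
    [AddCommMonoid P'] [AddCommMonoid Q] [AddCommMonoid Q'] [AddCommMonoid S] [AddCommMonoid T]
    [Module R P] [Module R P'] [Module R Q] [Module R Q'] [Module R S] [Module R T]
    (f : P →ₗ[R] Q →ₗ[R] S) (g : P' →ₗ[R] Q' →ₗ[R] T) (p : P ⊗[R] P') (q : Q) (q' : Q') :
    TensorProduct.map₂ f g p (q ⊗ₜ q') = TensorProduct.map (f.flip q) (g.flip q') p := by
  induction p with
  | zero => simp
  | tmul x y => simp
  | add x y hx hy => simp [hx, hy]

namespace ClassCalculus

open CrossCoproduct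

variable {k : Type*} [Field k] {G M : Type*} [Group G] [Group M] {φ : M →* MulAut G} {t₀ : M}
variable [Fintype G] [DecidableEq G] [Fintype M] [DecidableEq M]

theorem leftCoact_leftMul (a : CrossCoproduct k φ) (ω : Form k φ t₀) :
    leftCoact k φ t₀ (leftMul k φ t₀ a ω) =
      TensorProduct.map₂ (LinearMap.mul k _) (leftMul k φ t₀)
        (Coalgebra.comul (R := k) a) (leftCoact k φ t₀ ω) := by
  refine LinearMap.ext_iff₂.1 (show (leftMul k φ t₀).compr₂ (leftCoact k φ t₀) =
    (TensorProduct.map₂ (LinearMap.mul k _) (leftMul k φ t₀)).compl₁₂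
      (Coalgebra.comul (R := k)) (leftCoact k φ t₀) from
    hom_ext fun s u => form_hom_ext fun m g x => ?_) a ω
  simp only [LinearMap.compr₂_apply, LinearMap.compl₁₂_apply, leftMul_δ, leftCoact_form, comul_δ',
    map_sum, LinearMap.sum_apply, TensorProduct.map₂_apply_tmul, TensorProduct.map_tmul,
    LinearMap.mul_apply', δ_mul]
  -- Here `b` comes from the coaction and `c` from the coproduct; the second tensor factor forces `c
  -- = b`.
  have key : ∀ b : M, (∑ c : M,
      ((if s * c⁻¹ = m * b⁻¹ then δ k φ (s * c⁻¹) (φ c u * φ b g) else 0) ⊗ₜ[k]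
        (if c = b then form k b (u * g) x else 0))) =
      if s = m then δ k φ (m * b⁻¹) (φ b (u * g)) ⊗ₜ[k] form k b (u * g) x else 0 := by
    intro b
    rw [Finset.sum_eq_single b (by intro c _ hc; simp [hc]) (by simp)]
    by_cases h : s = m <;> simp [h]
  rw [Finset.sum_congr rfl fun b _ => key b]
  by_cases h : s = m <;> simp [h, leftCoact_form]

theorem leftCoact_rightMul (a : CrossCoproduct k φ) (ω : Form k φ t₀) :
    leftCoact k φ t₀ (rightMul k φ t₀ a ω) =
      TensorProduct.map₂ (LinearMap.mul k _).flip (rightMul k φ t₀)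
        (Coalgebra.comul (R := k) a) (leftCoact k φ t₀ ω) := by
  refine LinearMap.ext_iff₂.1 (show (rightMul k φ t₀).compr₂ (leftCoact k φ t₀) =
    (TensorProduct.map₂ (LinearMap.mul k _).flip (rightMul k φ t₀)).compl₁₂
      (Coalgebra.comul (R := k)) (leftCoact k φ t₀) from
    hom_ext fun s u => form_hom_ext fun m g x => ?_) a ω
  simp only [LinearMap.compr₂_apply, LinearMap.compl₁₂_apply, rightMul_δ, leftCoact_form, comul_δ',
    map_sum, LinearMap.sum_apply, TensorProduct.map₂_apply_tmul, TensorProduct.map_tmul,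
    LinearMap.mul_apply', δ_mul,
    LinearMap.flip_apply]
  -- Right multiplication shifts the `M`-index, so the surviving term is now `c = b * x.1.right`.
  have key : ∀ b : M, (∑ c : M,
      ((if m * b⁻¹ = s * c⁻¹ then δ k φ (m * b⁻¹) (φ b g * φ c u) else 0) ⊗ₜ[k]
        (if b * x.1.right = c then
          form k b (g * φ x.1.right u) (conjBy (inl u⁻¹) x) else 0))) =
      if m * x.1.right = s then δ k φ (m * b⁻¹) (φ b (g * φ x.1.right u)) ⊗ₜ[k]
        form k b (g * φ x.1.right u) (conjBy (inl u⁻¹) x) else 0 := by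
    intro b
    rw [Finset.sum_eq_single (b * x.1.right)
      (by intro c _ hc; simp [Ne.symm hc]) (by simp)]
    have : m * b⁻¹ = s * (b * x.1.right)⁻¹ ↔ m * x.1.right = s := by
      rw [mul_inv_rev, ← mul_assoc, mul_left_inj, eq_mul_inv_iff_mul_eq]
    simp only [this]
    by_cases h : m * x.1.right = s <;> simp [h]
  rw [Finset.sum_congr rfl fun b _ => key b]
  by_cases h : m * x.1.right = s <;> simp [h, leftCoact_form]

theorem rightCoact_leftMul (a : CrossCoproduct k φ) (ω : Form k φ t₀) :
    rightCoact k φ t₀ (leftMul k φ t₀ a ω) =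
      TensorProduct.map₂ (leftMul k φ t₀) (LinearMap.mul k _)
        (Coalgebra.comul (R := k) a) (rightCoact k φ t₀ ω) := by
  refine LinearMap.ext_iff₂.1 (show (leftMul k φ t₀).compr₂ (rightCoact k φ t₀) =
    (TensorProduct.map₂ (leftMul k φ t₀) (LinearMap.mul k _)).compl₁₂
      (Coalgebra.comul (R := k)) (rightCoact k φ t₀) from
    hom_ext fun s u => form_hom_ext fun m g x => ?_) a ω
  simp only [LinearMap.compr₂_apply, LinearMap.compl₁₂_apply, leftMul_δ, rightCoact_form, comul_δ',
    map_sum, LinearMap.sum_apply, TensorProduct.map₂_apply_tmul, TensorProduct.map_tmul,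
    LinearMap.mul_apply', δ_mul]
  have key : ∀ b : M, (∑ c : M,
      ((if s * c⁻¹ = m * b⁻¹ then form k (m * b⁻¹) (φ c u * φ b g) (conjBy (inr b) x) else 0) ⊗ₜ[k]
        (if c = b then δ k φ c (u * (g * x.1.left⁻¹)) else 0))) =
      if s = m then form k (m * b⁻¹) (φ b (u * g)) (conjBy (inr b) x) ⊗ₜ[k]
        δ k φ b (u * g * x.1.left⁻¹) else 0 := by
    intro b
    rw [Finset.sum_eq_single b (by intro c _ hc; simp [hc]) (by simp)]
    by_cases h : s = m <;> simp [h, mul_assoc]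
  rw [Finset.sum_congr rfl fun b _ => key b]
  by_cases h : s = m <;> simp [h, rightCoact_form]

theorem rightCoact_rightMul (a : CrossCoproduct k φ) (ω : Form k φ t₀) :
    rightCoact k φ t₀ (rightMul k φ t₀ a ω) =
      TensorProduct.map₂ (rightMul k φ t₀) (LinearMap.mul k _).flip
        (Coalgebra.comul (R := k) a) (rightCoact k φ t₀ ω) := by
  refine LinearMap.ext_iff₂.1 (show (rightMul k φ t₀).compr₂ (rightCoact k φ t₀) =
    (TensorProduct.map₂ (rightMul k φ t₀) (LinearMap.mul k _).flip).compl₁₂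
      (Coalgebra.comul (R := k)) (rightCoact k φ t₀) from
    hom_ext fun s u => form_hom_ext fun m g x => ?_) a ω
  simp only [LinearMap.compr₂_apply, LinearMap.compl₁₂_apply, rightMul_δ, rightCoact_form,
    comul_δ', map_sum, LinearMap.sum_apply, TensorProduct.map₂_apply_tmul, TensorProduct.map_tmul,
    LinearMap.mul_apply',
    δ_mul, LinearMap.flip_apply, conjBy_inr_right]
  have key : ∀ b : M, (∑ c : M,
      ((if m * b⁻¹ * (b * x.1.right * b⁻¹) = s * c⁻¹ then form k (m * b⁻¹)
        (φ b g * φ (b * x.1.right * b⁻¹) (φ c u)) (conjBy (inl (φ c u)⁻¹) (conjBy (inr b) x))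
          else 0) ⊗ₜ[k]
        (if b = c then δ k φ b (g * x.1.left⁻¹ * u) else 0))) =
      if m * x.1.right = s then form k (m * b⁻¹) (φ b (g * φ x.1.right u))
        (conjBy (inr b) (conjBy (inl u⁻¹) x)) ⊗ₜ[k] δ k φ b (g * x.1.left⁻¹ * u) else 0 := by
    intro b
    rw [Finset.sum_eq_single b (by intro c _ hc; simp [Ne.symm hc]) (by simp)]
    have : m * b⁻¹ * (b * x.1.right * b⁻¹) = s * b⁻¹ ↔ m * x.1.right = s := by
      rw [← mul_assoc, mul_left_inj]
      simp [mul_assoc]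
    rw [conjBy_inr_inl]
    simp only [this]
    by_cases h : m * x.1.right = s <;> simp [h]
  rw [Finset.sum_congr rfl fun b _ => key b]
  by_cases h : m * x.1.right = s
  · simp only [h, if_true, rightCoact_form, conjBy_inl_left]
    refine Finset.sum_congr rfl fun b _ => ?_
    congr 2
    simp [mul_assoc]
  · simp [h]

/-! ### The biinvariant form `θ` and the inner differential. -/

instance : Fintype (conjugatesOf (inr t₀ : G ⋊[φ] M)) := Fintype.ofFinite _

variable (k φ t₀) in
/-- The biinvariant 1-form `θ` with `d = [θ, ·]`. -/
def theta : Form k φ t₀ :=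
  ∑ m : M, ∑ x : conjugatesOf (inr t₀ : G ⋊[φ] M),
    if x.1.left = 1 then form k m 1 x else 0

theorem leftCoact_theta : leftCoact k φ t₀ (theta k φ t₀) = 1 ⊗ₜ[k] theta k φ t₀ := by
  have h : ∀ (m : M) (x : conjugatesOf (inr t₀ : G ⋊[φ] M)),
      leftCoact k φ t₀ (if x.1.left = 1 then form k m 1 x else 0) =
        ∑ b, δ k φ (m * b⁻¹) 1 ⊗ₜ[k] (if x.1.left = 1 then form k b 1 x else 0) := by
    intro m x
    split_ifs <;> simp [leftCoact_form]
  simp only [theta, map_sum, h]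
  rw [Finset.sum_congr rfl fun m _ => Finset.sum_comm, Finset.sum_comm, TensorProduct.tmul_sum,
    one_eq]
  refine Finset.sum_congr rfl fun b _ => ?_
  simp only [← TensorProduct.tmul_sum, TensorProduct.sum_tmul]
  exact Fintype.sum_equiv (Equiv.mulRight b⁻¹) _ _ fun c => rfl

/-- Conjugation by `M` preserves triviality of the `G`-part, so the coaction only permutes the
summands of `θ`. -/
theorem rightCoact_theta : rightCoact k φ t₀ (theta k φ t₀) = theta k φ t₀ ⊗ₜ[k] 1 := by
  have h : ∀ (m : M) (x : conjugatesOf (inr t₀ : G ⋊[φ] M)),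
      rightCoact k φ t₀ (if x.1.left = 1 then form k m 1 x else 0) =
        ∑ b, (if (conjBy (inr b) x).1.left = 1 then form k (m * b⁻¹) 1 (conjBy (inr b) x) else 0)
          ⊗ₜ[k] δ k φ b 1 := by
    intro m x
    by_cases hx : x.1.left = 1 <;> simp [hx, rightCoact_form]
  simp only [theta, map_sum, h, one_eq, TensorProduct.sum_tmul, TensorProduct.tmul_sum]
  rw [Finset.sum_congr rfl fun m _ => Finset.sum_comm, Finset.sum_comm]
  refine Finset.sum_congr rfl fun b _ => ?_
  refine Fintype.sum_equiv (Equiv.mulRight b⁻¹) _ _ fun c => ?_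
  exact Fintype.sum_equiv (conjEquiv (inr b)) _ _ fun x => rfl

variable (k φ t₀) in
/-- The differential `d a = θ a - a θ`. -/
def diff : CrossCoproduct k φ →ₗ[k] Form k φ t₀ :=
  (rightMul k φ t₀).flip (theta k φ t₀) - (leftMul k φ t₀).flip (theta k φ t₀)

theorem diff_apply (a : CrossCoproduct k φ) : diff k φ t₀ a =
    rightMul k φ t₀ a (theta k φ t₀) - leftMul k φ t₀ a (theta k φ t₀) :=
  rfl

theorem diff_mul (a b : CrossCoproduct k φ) : diff k φ t₀ (a * b) =
    leftMul k φ t₀ a (diff k φ t₀ b) + rightMul k φ t₀ b (diff k φ t₀ a) := by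
  have h1 : leftMul k φ t₀ (a * b) = leftMul k φ t₀ a * leftMul k φ t₀ b :=
    map_mul (leftAct k φ t₀) a b
  have h2 : rightMul k φ t₀ (a * b) = rightMul k φ t₀ b * rightMul k φ t₀ a :=
    map_mul (rightAct k φ t₀) (MulOpposite.op b) (MulOpposite.op a)
  simp only [diff_apply, h1, h2, map_sub, Module.End.mul_apply, leftMul_rightMul]
  abel

/-- Since `θ` is coinvariant, `θ a - a θ` is sent to `a₁ ⊗ (θ a₂ - a₂ θ)`. -/
theorem leftCoact_diff (a : CrossCoproduct k φ) : leftCoact k φ t₀ (diff k φ t₀ a) =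
    (diff k φ t₀).lTensor _ (Coalgebra.comul (R := k) a) := by
  have h1 : (LinearMap.mul k (CrossCoproduct k φ)).flip.flip 1 = LinearMap.id := by ext; simp
  have h2 : (LinearMap.mul k (CrossCoproduct k φ)).flip 1 = LinearMap.id := by ext; simp
  rw [diff_apply, map_sub, leftCoact_leftMul, leftCoact_rightMul, leftCoact_theta,
    map₂_tmul_right, map₂_tmul_right, h1, h2, diff, LinearMap.lTensor_sub]
  rfl

theorem rightCoact_diff (a : CrossCoproduct k φ) : rightCoact k φ t₀ (diff k φ t₀ a) =
    (diff k φ t₀).rTensor _ (Coalgebra.comul (R := k) a) := by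
  have h1 : (LinearMap.mul k (CrossCoproduct k φ)).flip.flip 1 = LinearMap.id := by ext; simp
  have h2 : (LinearMap.mul k (CrossCoproduct k φ)).flip 1 = LinearMap.id := by ext; simp
  rw [diff_apply, map_sub, rightCoact_leftMul, rightCoact_rightMul, rightCoact_theta,
    map₂_tmul_right, map₂_tmul_right, h1, h2, diff, LinearMap.rTensor_sub]
  rfl

theorem rightMul_theta (s : M) (u : G) : rightMul k φ t₀ (δ k φ s u) (theta k φ t₀) =
    ∑ x : conjugatesOf (inr t₀ : G ⋊[φ] M), if x.1.left = 1 then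
      form k (s * x.1.right⁻¹) (φ x.1.right u) (conjBy (inl u⁻¹) x) else 0 := by
  simp only [theta, map_sum, apply_ite, map_zero, rightMul_δ]
  rw [Finset.sum_comm]
  refine Finset.sum_congr rfl fun x _ => ?_
  simp only [← eq_mul_inv_iff_mul_eq]
  split_ifs <;> simp

theorem leftMul_theta (s : M) (u : G) : leftMul k φ t₀ (δ k φ s u) (theta k φ t₀) =
    ∑ x : conjugatesOf (inr t₀ : G ⋊[φ] M), if x.1.left = 1 then
      form k s u x else 0 := by
  simp only [theta, map_sum, apply_ite, map_zero, leftMul_δ]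
  rw [Finset.sum_comm]
  refine Finset.sum_congr rfl fun x _ => ?_
  split_ifs <;> simp

/-- Write `t = x.1.right`. Left multiplication cuts down to `M`-index `m`. The part `a θ` has index
`m t ≠ m` and dies; in `θ a` the summand of `y` has index `m t y.1.right⁻¹`, so only `y = x`
survives. -/
theorem leftMul_diff (h : t₀ ≠ 1) (m : M) (g u : G) (x : conjugatesOf (inr t₀ : G ⋊[φ] M))
    (hx : x.1.left = 1) : leftMul k φ t₀ (δ k φ m (g * (φ x.1.right u)⁻¹))
      (diff k φ t₀ (δ k φ (m * x.1.right) u)) = form k m g (conjBy (inl u⁻¹) x) := by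
  have hr : x.1.right ≠ 1 := fun h1 => h (isConj_one_left.1 (h1 ▸ isConj_right x))
  rw [diff_apply, map_sub, rightMul_theta, leftMul_theta, map_sum, map_sum]
  rw [Finset.sum_eq_single x, Finset.sum_eq_zero]
  · simp [hx, leftMul_δ]
  · intro y _
    split_ifs <;> simp [leftMul_δ, hr]
  · intro y _ hy
    split_ifs with hy1
    · have : m ≠ m * x.1.right * y.1.right⁻¹ := by
        intro hm
        rw [mul_assoc, left_eq_mul, mul_inv_eq_one] at hm
        exact hy (Subtype.ext (SemidirectProduct.ext (hy1.trans hx.symm) hm.symm))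
      rw [leftMul_δ, if_neg this]
    · simp
  · simp

theorem span_diff (h : t₀ ≠ 1) : Submodule.span k {ω : Form k φ t₀ |
    ∃ a b, ω = leftMul k φ t₀ a (diff k φ t₀ b)} = ⊤ := by
  rw [eq_top_iff, ← (Finsupp.basisSingleOne (R := k)).span_eq, Submodule.span_le]
  rintro _ ⟨⟨m, g, x⟩, rfl⟩
  obtain ⟨u, y, hy, rfl⟩ := exists_eq_conjBy x
  refine Submodule.subset_span
    ⟨δ k φ m (g * (φ y.1.right u⁻¹)⁻¹), δ k φ (m * y.1.right) u⁻¹, ?_⟩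
  · rw [leftMul_diff h _ _ _ _ hy, inv_inv]
    simp [form]

end ClassCalculus

open ClassCalculus in
/-- The bicovariant calculus on `k(M) ◁< kG` attached to the conjugacy class of `t₀ ≠ e`. -/
def classCalculus (k : Type*) [Field k] {G M : Type*} [Group G] [Group M] (φ : M →* MulAut G)
    (t₀ : M) [Fintype G] [DecidableEq G] [Fintype M] [DecidableEq M] (h : t₀ ≠ 1) :
    BicovariantCalculus k (CrossCoproduct k φ) where
  Ω := Form k φ t₀
  lact := leftAct k φ t₀
  ract := rightAct k φ t₀
  lact_ract := leftMul_rightMul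
  d := diff k φ t₀
  leibniz := diff_mul
  span_d := span_diff h
  coL := leftCoact k φ t₀
  coR := rightCoact k φ t₀
  coL_counit := leftCoact_counit
  coL_coassoc := leftCoact_coassoc
  coR_counit := rightCoact_counit
  coR_coassoc := rightCoact_coassoc
  coL_coR := leftCoact_rightCoact
  coL_lmul := leftCoact_leftMul
  coL_rmul := leftCoact_rightMul
  coR_lmul := rightCoact_leftMul
  coR_rmul := rightCoact_rightMul
  coL_d := leftCoact_diff
  coR_d := rightCoact_diff

end

end NCCalc

namespace NCCalc

noncomputable section

/-! ### A bicovariant calculus is determined by its quantum tangent space. -/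

namespace BicovariantCalculus

variable {k A : Type*} [Field k] [Ring A] [HopfAlgebra k A]

/-- The map `a ⊗ b ↦ a d b`. -/
def mulD (Γ : BicovariantCalculus k A) : A ⊗[k] A →ₗ[k] Γ.Ω :=
  TensorProduct.lift (Γ.lmul.compl₂ Γ.d)

@[simp]
theorem mulD_tmul (Γ : BicovariantCalculus k A) (a b : A) :
    Γ.mulD (a ⊗ₜ b) = Γ.lact a (Γ.d b) :=
  rfl

theorem mulD_surjective (Γ : BicovariantCalculus k A) : Function.Surjective Γ.mulD := by
  rw [← LinearMap.range_eq_top, eq_top_iff, ← Γ.span_d, Submodule.span_le]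
  rintro _ ⟨a, b, rfl⟩
  exact ⟨a ⊗ₜ b, rfl⟩

theorem maurerCartan_apply (Γ : BicovariantCalculus k A) (a : A) : Γ.maurerCartan a =
    Γ.mulD ((HopfAlgebra.antipode k).rTensor A (Coalgebra.comul (R := k) a)) := by
  rw [maurerCartan, LinearMap.comp_apply]
  induction Coalgebra.comul (R := k) a with
  | zero => simp
  | tmul x y => rfl
  | add x y hx hy => simp only [map_add, hx, hy]

/-- The map `a ⊗ b ↦ a b₁ ⊗ b₂`. -/
def comulShift (k A : Type*) [Field k] [Ring A] [HopfAlgebra k A] : A ⊗[k] A →ₗ[k] A ⊗[k] A :=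
  (LinearMap.mul' k A).rTensor A ∘ₗ (TensorProduct.assoc k A A A).symm.toLinearMap ∘ₗ
    (Coalgebra.comul (R := k)).lTensor A

/-- By coassociativity the left side is `b₁ S(b₂) d b₃`, which the antipode axiom collapses. -/
theorem lift_lmul_maurerCartan (Γ : BicovariantCalculus k A) (b : A) :
    TensorProduct.lift Γ.lmul (Γ.maurerCartan.lTensor A (Coalgebra.comul (R := k) b)) = Γ.d b := by
  have h1 : ∀ z : A ⊗[k] A, TensorProduct.lift Γ.lmul (Γ.maurerCartan.lTensor A z) =
      Γ.mulD ((LinearMap.mul' k A ∘ₗ (HopfAlgebra.antipode k).lTensor A).rTensor A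
        ((TensorProduct.assoc k A A A).symm ((Coalgebra.comul (R := k)).lTensor A z))) := by
    intro z
    induction z with
    | zero => simp
    | add x y hx hy => simp only [map_add, hx, hy]
    | tmul x y =>
      simp only [LinearMap.lTensor_tmul, TensorProduct.lift.tmul, maurerCartan_apply]
      induction Coalgebra.comul (R := k) y with
      | zero => simp
      | add u v hu hv => simp only [map_add, TensorProduct.tmul_add, hu, hv]
      | tmul u v =>
        simp only [LinearMap.rTensor_tmul, mulD_tmul, TensorProduct.assoc_symm_tmul,
          LinearMap.comp_apply, LinearMap.lTensor_tmul, LinearMap.mul'_apply, map_mul,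
          Module.End.mul_apply]
        rfl
  rw [h1, Coalgebra.coassoc_symm_apply, ← LinearMap.comp_apply (LinearMap.rTensor A _),
    ← LinearMap.rTensor_comp, LinearMap.comp_assoc, HopfAlgebra.mul_antipode_lTensor_comul,
    LinearMap.rTensor_comp, LinearMap.comp_apply, Coalgebra.rTensor_counit_comul]
  simp

theorem mulD_eq (Γ : BicovariantCalculus k A) : Γ.mulD =
    TensorProduct.lift Γ.lmul ∘ₗ Γ.maurerCartan.lTensor A ∘ₗ comulShift k A := by
  refine TensorProduct.ext' fun a b => ?_
  have h : ∀ z : A ⊗[k] A, TensorProduct.lift Γ.lmul (Γ.maurerCartan.lTensor A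
      ((LinearMap.mul' k A).rTensor A ((TensorProduct.assoc k A A A).symm (a ⊗ₜ z)))) =
      Γ.lact a (TensorProduct.lift Γ.lmul (Γ.maurerCartan.lTensor A z)) := by
    intro z
    induction z with
    | zero => simp
    | add x y hx hy => simp only [map_add, TensorProduct.tmul_add, hx, hy]
    | tmul x y => simp [Calculus.lmul]
  rw [LinearMap.comp_apply, LinearMap.comp_apply, comulShift, LinearMap.comp_apply,
    LinearMap.comp_apply, LinearMap.lTensor_tmul, LinearEquiv.coe_coe, h, lift_lmul_maurerCartan, mulD_tmul]

/-- The projection `ω ↦ S(ω₋₁) ω₀` of the 1-forms onto the left-invariant ones. -/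
def invProj (Γ : BicovariantCalculus k A) : Γ.Ω →ₗ[k] Γ.Ω :=
  TensorProduct.lift (Γ.lmul ∘ₗ HopfAlgebra.antipode k) ∘ₗ Γ.coL

theorem invProj_d (Γ : BicovariantCalculus k A) (a : A) :
    Γ.invProj (Γ.d a) = Γ.maurerCartan a := by
  rw [invProj, LinearMap.comp_apply, Γ.coL_d, maurerCartan_apply]
  induction Coalgebra.comul (R := k) a with
  | zero => simp
  | tmul x y => rfl
  | add x y hx hy => simp only [map_add, hx, hy]

/-- As `S` reverses products, `S(a₁ ω₋₁) a₂ ω₀ = S(ω₋₁) S(a₁) a₂ ω₀`. -/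
theorem invProj_lact (Γ : BicovariantCalculus k A) (a : A) (ω : Γ.Ω) :
    Γ.invProj (Γ.lact a ω) = Coalgebra.counit (R := k) a • Γ.invProj ω := by
  rw [invProj, LinearMap.comp_apply, LinearMap.comp_apply, Γ.coL_lmul]
  induction Γ.coL ω with
  | zero => simp
  | add x y hx hy => simp only [map_add, hx, hy, smul_add]
  | tmul x ω =>
    rw [map₂_tmul_right]
    have h : ∀ z : A ⊗[k] A, TensorProduct.lift (Γ.lmul ∘ₗ HopfAlgebra.antipode k)
        (TensorProduct.map ((LinearMap.mul k A).flip x) (Γ.lmul.flip ω) z) =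
        Γ.lact (HopfAlgebra.antipode k x) (Γ.lact (LinearMap.mul' k A
          ((HopfAlgebra.antipode k).rTensor A z)) ω) := by
      intro z
      induction z with
      | zero => simp
      | add u v hu hv => simp only [map_add, hu, hv, LinearMap.add_apply]
      | tmul u v =>
        simp [Calculus.lmul, HopfAlgebra.antipode_mul_antidistrib]
    rw [h, HopfAlgebra.mul_antipode_rTensor_comul_apply]
    simp [Calculus.lmul]

/-- The coaction of `a db` is `a₁ b₁ ⊗ a₂ db₂`, and `invProj` replaces `a₂` by its counit. So the
form `a db` determines `a b₁ ⊗ ϖ(b₂)`. -/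
theorem lTensor_invProj_coL (Γ : BicovariantCalculus k A) (z : A ⊗[k] A) :
    Γ.invProj.lTensor A (Γ.coL (Γ.mulD z)) = Γ.maurerCartan.lTensor A (comulShift k A z) := by
  induction z with
  | zero => simp
  | add u v hu hv => simp only [map_add, hu, hv]
  | tmul a b =>
    rw [mulD_tmul, Γ.coL_lmul, Γ.coL_d, comulShift, LinearMap.comp_apply, LinearMap.comp_apply,
      LinearMap.lTensor_tmul]
    induction Coalgebra.comul (R := k) b with
    | zero => simp
    | add u v hu hv => simp only [map_add, hu, hv, TensorProduct.tmul_add]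
    | tmul x y =>
      have h : ∀ z : A ⊗[k] A, Γ.invProj.lTensor A
          (TensorProduct.map ((LinearMap.mul k A).flip x) (Γ.lmul.flip (Γ.d y)) z) =
          (TensorProduct.rid k A ((Coalgebra.counit (R := k)).lTensor A z) * x) ⊗ₜ
            Γ.maurerCartan y := by
        intro z
        induction z with
        | zero => simp
        | add u v hu hv => simp only [map_add, hu, hv, add_mul, TensorProduct.add_tmul]
        | tmul u v =>
          have : Γ.invProj (Γ.lmul v (Γ.d y)) = _ := Γ.invProj_lact v (Γ.d y)
          simp [this, invProj_d, TensorProduct.smul_tmul']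
      rw [LinearMap.lTensor_tmul, map₂_tmul_right, h,
        Coalgebra.lTensor_counit_comul]
      simp

/-- Each map factors through the other, by `mulD_eq` and `lTensor_invProj_coL`. -/
theorem ker_mulD (Γ : BicovariantCalculus k A) : LinearMap.ker Γ.mulD =
    LinearMap.ker (Γ.maurerCartan.lTensor A ∘ₗ comulShift k A) := by
  ext z
  rw [LinearMap.mem_ker, LinearMap.mem_ker]
  constructor
  · intro h
    rw [LinearMap.comp_apply, ← lTensor_invProj_coL, h, map_zero, map_zero]
  · intro h
    rw [mulD_eq, LinearMap.comp_apply, h, map_zero]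

universe w₁ w₂

theorem ker_mulD_le {Γ : BicovariantCalculus.{w₁} k A} {Γ' : BicovariantCalculus.{w₂} k A}
    (h : LinearMap.ker Γ.maurerCartan ≤ LinearMap.ker Γ'.maurerCartan) :
    LinearMap.ker Γ.mulD ≤ LinearMap.ker Γ'.mulD := by
  -- The map is forced on the range of `ϖ` and extended arbitrarily beyond it; only linearity
  -- matters.
  obtain ⟨g, hg⟩ : ∃ g : Γ.Ω →ₗ[k] Γ'.Ω, g ∘ₗ Γ.maurerCartan = Γ'.maurerCartan := by
    obtain ⟨g, hg⟩ := LinearMap.exists_extend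
      ((LinearMap.ker Γ.maurerCartan).liftQ Γ'.maurerCartan h ∘ₗ
        Γ.maurerCartan.quotKerEquivRange.symm.toLinearMap)
    refine ⟨g, LinearMap.ext fun a => ?_⟩
    have h1 := LinearMap.congr_fun hg ⟨Γ.maurerCartan a, a, rfl⟩
    have h2 : Γ.maurerCartan.quotKerEquivRange.symm ⟨Γ.maurerCartan a, a, rfl⟩ =
        Submodule.Quotient.mk a := by
      rw [LinearEquiv.symm_apply_eq]
      rfl
    simp only [LinearMap.comp_apply, LinearEquiv.coe_coe, h2] at h1
    exact h1
  rw [ker_mulD, ker_mulD, ← hg, LinearMap.lTensor_comp, LinearMap.comp_assoc]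
  exact LinearMap.ker_le_ker_comp _ _

theorem ker_maurerCartan_eq {Γ : BicovariantCalculus.{w₁} k A} {Γ' : BicovariantCalculus.{w₂} k A}
    (h : Γ.tangentSpace = Γ'.tangentSpace) :
    LinearMap.ker Γ.maurerCartan = LinearMap.ker Γ'.maurerCartan := by
  rw [tangentSpace, tangentSpace, LinearMap.range_dualMap_eq_dualAnnihilator_ker,
    LinearMap.range_dualMap_eq_dualAnnihilator_ker] at h
  exact Subspace.dualAnnihilator_inj.1 h

/-- A bicovariant calculus is determined by its quantum tangent space. -/
theorem isomorphic_of_tangentSpace_eq {Γ : BicovariantCalculus.{w₁} k A}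
    {Γ' : BicovariantCalculus.{w₂} k A} (h : Γ.tangentSpace = Γ'.tangentSpace) :
    Γ.Isomorphic Γ' := by
  have hker : LinearMap.ker Γ.mulD = LinearMap.ker Γ'.mulD :=
    le_antisymm (ker_mulD_le (ker_maurerCartan_eq h).le)
      (ker_mulD_le (ker_maurerCartan_eq h).ge)
  -- Both spaces of forms are `A ⊗ A` modulo the same kernel.
  obtain ⟨f, hf⟩ : ∃ f : Γ.Ω ≃ₗ[k] Γ'.Ω, ∀ z, f (Γ.mulD z) = Γ'.mulD z :=
    ⟨(Γ.mulD.quotKerEquivOfSurjective Γ.mulD_surjective).symm ≪≫ₗ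
      Submodule.quotEquivOfEq _ _ hker ≪≫ₗ
      Γ'.mulD.quotKerEquivOfSurjective Γ'.mulD_surjective, fun z => by
        have : (Γ.mulD.quotKerEquivOfSurjective Γ.mulD_surjective).symm (Γ.mulD z) =
            Submodule.Quotient.mk z := by
          rw [LinearEquiv.symm_apply_eq]; rfl
        simp only [LinearEquiv.trans_apply, this]
        rfl⟩
  have ind : ∀ {p : Γ.Ω → Prop}, (∀ x y, p x → p y → p (x + y)) →
      (∀ a b, p (Γ.mulD (a ⊗ₜ b))) → ∀ ω, p ω := by
    intro p hadd hp ω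
    obtain ⟨z, rfl⟩ := Γ.mulD_surjective ω
    induction z with
    | zero => simpa using hp 0 0
    | tmul a b => exact hp a b
    | add x y hx hy => rw [map_add]; exact hadd _ _ hx hy
  have hd : ∀ a, f (Γ.d a) = Γ'.d a := fun a => by
    have := hf (1 ⊗ₜ a)
    simpa using this
  have hl : ∀ a ω, f (Γ.lact a ω) = Γ'.lact a (f ω) := by
    intro c
    refine ind (fun x y hx hy => by simp only [map_add, hx, hy]) fun a b => ?_
    have := hf ((c * a) ⊗ₜ b)
    rw [hf]
    simpa using this
  have hr : ∀ a ω, f (Γ.ract (MulOpposite.op a) ω) = Γ'.ract (MulOpposite.op a) (f ω) := by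
    intro c
    refine ind (fun x y hx hy => by simp only [map_add, hx, hy]) fun a b => ?_
    -- Since `a (db) c = a d(bc) - a b dc`, right multiplication is determined by left
    -- multiplication and `d`.
    have h1 := eq_sub_of_add_eq' (Γ.leibniz b c).symm
    have h2 := eq_sub_of_add_eq' (Γ'.leibniz b c).symm
    rw [mulD_tmul, ← Γ.lact_ract, h1, hl, map_sub, hl, hd, hl, hd, hd, ← Γ'.lact_ract, h2]
  refine ⟨f, hl, hr, hd, ?_, ?_⟩
  · refine ind (fun x y hx hy => by simp only [map_add, hx, hy]) fun a b => ?_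
    rw [mulD_tmul, hl, hd, Γ.coL_lmul, Γ'.coL_lmul, Γ.coL_d, Γ'.coL_d]
    induction Coalgebra.comul (R := k) b with
    | zero => simp
    | add u v hu hv => simp only [map_add, hu, hv]
    | tmul x y =>
      simp only [LinearMap.lTensor_tmul, map₂_tmul_right]
      induction Coalgebra.comul (R := k) a with
      | zero => simp
      | add u v hu hv => simp only [map_add, hu, hv]
      | tmul u v => simp [Calculus.lmul, hl, hd]
  · refine ind (fun x y hx hy => by simp only [map_add, hx, hy]) fun a b => ?_
    rw [mulD_tmul, hl, hd, Γ.coR_lmul, Γ'.coR_lmul, Γ.coR_d, Γ'.coR_d]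
    induction Coalgebra.comul (R := k) b with
    | zero => simp
    | add u v hu hv => simp only [map_add, hu, hv]
    | tmul x y =>
      simp only [LinearMap.rTensor_tmul, map₂_tmul_right]
      induction Coalgebra.comul (R := k) a with
      | zero => simp
      | add u v hu hv => simp only [map_add, hu, hv]
      | tmul u v => simp [Calculus.lmul, hl, hd]

end BicovariantCalculus

end

end NCCalc

namespace NCCalc

noncomputable section

/-! ### Irreducibility. -/

section Slices

variable {k A V : Type*} [Field k] [AddCommGroup A] [Module k A] [AddCommGroup V] [Module k V]

/-- Turns the subcomodule condition into stability under functionals, which can be computed on basis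
vectors. -/
theorem lid_rTensor_mem {N : Submodule k V} (f : Module.Dual k A) {z : A ⊗[k] V}
    (hz : z ∈ LinearMap.range (N.subtype.lTensor A)) :
    TensorProduct.lid k V (f.rTensor V z) ∈ N := by
  obtain ⟨y, rfl⟩ := hz
  induction y with
  | zero => simp
  | add u v hu hv => simpa only [map_add] using N.add_mem hu hv
  | tmul a n => simpa using N.smul_mem _ n.2

theorem rid_lTensor_mem {N : Submodule k V} (f : Module.Dual k A) {z : V ⊗[k] A}
    (hz : z ∈ LinearMap.range (N.subtype.rTensor A)) :
    TensorProduct.rid k V (f.lTensor V z) ∈ N := by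
  obtain ⟨y, rfl⟩ := hz
  induction y with
  | zero => simp
  | add u v hu hv => simpa only [map_add] using N.add_mem hu hv
  | tmul a n => simpa using N.smul_mem _ a.2

end Slices

namespace ClassCalculus

open CrossCoproduct

variable {k : Type*} [Field k] {G M : Type*} [Group G] [Group M] {φ : M →* MulAut G} {t₀ : M}
variable [Fintype G] [DecidableEq G] [Fintype M] [DecidableEq M]

/-- The action of a functional through the left coaction. -/
def leftSlice (f : Module.Dual k (CrossCoproduct k φ)) : Form k φ t₀ →ₗ[k] Form k φ t₀ :=
  (TensorProduct.lid k _).toLinearMap ∘ₗ f.rTensor _ ∘ₗ leftCoact k φ t₀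

/-- The action of a functional through the right coaction. -/
def rightSlice (f : Module.Dual k (CrossCoproduct k φ)) : Form k φ t₀ →ₗ[k] Form k φ t₀ :=
  (TensorProduct.rid k _).toLinearMap ∘ₗ f.lTensor _ ∘ₗ rightCoact k φ t₀

omit [Fintype G] in
theorem leftSlice_form (s : M) (v : G) (m : M) (g : G) (x : conjugatesOf (inr t₀ : G ⋊[φ] M)) :
    leftSlice (coord k φ s v) (form k m g x) =
      if φ (s⁻¹ * m) g = v then form k (s⁻¹ * m) g x else 0 := by
  simp only [leftSlice, LinearMap.comp_apply, leftCoact_form, map_sum, LinearMap.rTensor_tmul,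
    coord_δ, LinearEquiv.coe_coe, TensorProduct.lid_tmul]
  rw [Finset.sum_eq_single (s⁻¹ * m)]
  · simp
  · intro b _ hb
    have : ¬m * b⁻¹ = s := fun h => hb (by rw [← h]; simp)
    simp [this]
  · simp

omit [Fintype G] in
theorem rightSlice_form (s : M) (v : G) (m : M) (g : G)
    (x : conjugatesOf (inr t₀ : G ⋊[φ] M)) :
    rightSlice (coord k φ s v) (form k m g x) =
      if g * x.1.left⁻¹ = v then form k (m * s⁻¹) (φ s g) (conjBy (inr s) x) else 0 := by
  simp only [rightSlice, LinearMap.comp_apply, rightCoact_form, map_sum, LinearMap.lTensor_tmul,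
    coord_δ, LinearEquiv.coe_coe, TensorProduct.rid_tmul]
  rw [Finset.sum_eq_single s]
  · simp
  · intro b _ hb
    simp [hb]
  · simp

/-- Closure under the bimodule and bicomodule structures. -/
structure IsStable (N : Submodule k (Form k φ t₀)) : Prop where
  leftMul_mem : ∀ a, ∀ ω ∈ N, leftMul k φ t₀ a ω ∈ N
  rightMul_mem : ∀ a, ∀ ω ∈ N, rightMul k φ t₀ a ω ∈ N
  leftSlice_mem : ∀ f, ∀ ω ∈ N, leftSlice f ω ∈ N
  rightSlice_mem : ∀ f, ∀ ω ∈ N, rightSlice f ω ∈ N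

/-- Left operations reach every `m'` and `g'`. For the class index, the right slice conjugates by `s
∈ M` and right multiplication by `u ∈ G`, which together are transitive. -/
theorem IsStable.form_mem {N : Submodule k (Form k φ t₀)} (hN : IsStable N) {m : M} {g : G}
    {x : conjugatesOf (inr t₀ : G ⋊[φ] M)} (h : form k m g x ∈ N) (m' : M) (g' : G)
    (y : conjugatesOf (inr t₀ : G ⋊[φ] M)) : form k m' g' y ∈ N := by
  have h1 : ∀ {m g x}, form k m g x ∈ N → ∀ m' g', form k m' g' x ∈ N := by
    intro m g x h m' g'
    have := hN.leftMul_mem (δ k φ m' (g' * g⁻¹)) _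
      (hN.leftSlice_mem (coord k φ (m * m'⁻¹) (φ m' g)) _ h)
    simpa [leftSlice_form, leftMul_δ] using this
  obtain ⟨c, hc⟩ := isConj_iff.1 (IsConj.trans (IsConj.symm x.2) y.2)
  obtain ⟨u, s, rfl⟩ : ∃ u s, c = inl u * inr s := ⟨_, _, (mk_eq_inl_mul_inr c).symm⟩
  obtain rfl : conjBy (inl u) (conjBy (inr s) x) = y := by
    rw [conjBy_conjBy]
    exact Subtype.ext hc
  have h2 := hN.rightSlice_mem (coord k φ s (g * x.1.left⁻¹)) _ h
  rw [rightSlice_form, if_pos rfl] at h2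
  have h3 := hN.rightMul_mem
    (δ k φ (m * s⁻¹ * (conjBy (inr s) x).1.right) u⁻¹) _ h2
  rw [rightMul_δ, if_pos rfl, inv_inv] at h3
  exact h1 h3 _ _

theorem IsStable.eq_bot_or_eq_top {N : Submodule k (Form k φ t₀)} (hN : IsStable N) :
    N = ⊥ ∨ N = ⊤ := by
  classical
  refine or_iff_not_imp_left.2 fun h => ?_
  obtain ⟨ω, hω, hne⟩ := N.ne_bot_iff.1 h
  obtain ⟨⟨m, g, x⟩, hi⟩ := Finsupp.ne_iff.1 hne
  -- From the innermost outwards the four operators test `m`, `x.1.right`, `g` and `x.1.left`;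
  -- together they extract one coefficient of a form.
  have key : rightSlice (coord k φ 1 (g * x.1.left⁻¹)) ∘ₗ leftSlice (coord k φ m g) ∘ₗ
      rightMul k φ t₀ (δ k φ (m * x.1.right) 1) ∘ₗ leftMul k φ t₀ (δ k φ m 1) =
      (Finsupp.lapply (m, g, x)).smulRight (form k 1 g x) := by
    refine form_hom_ext fun m' g' x' => ?_
    simp only [LinearMap.comp_apply, LinearMap.smulRight_apply, Finsupp.lapply_apply]
    have h1 : form k m' g' x' (m, g, x) = if m = m' ∧ x'.1.right = x.1.right ∧ g' = g ∧
        x'.1.left = x.1.left then 1 else 0 := by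
      rw [form, Finsupp.single_apply]
      refine if_congr ?_ rfl rfl
      simp only [Prod.mk.injEq, Subtype.ext_iff, SemidirectProduct.ext_iff]
      tauto
    rw [h1, leftMul_δ]
    by_cases hm : m = m'
    · subst hm
      rw [if_pos rfl, rightMul_δ]
      by_cases ht : x'.1.right = x.1.right
      · rw [if_pos (by rw [ht])]
        simp only [map_one, mul_one, one_mul, inv_one, conjBy_one, leftSlice_form,
          inv_mul_cancel, MulAut.one_apply]
        by_cases hg : g' = g
        · subst hg
          rw [if_pos rfl, rightSlice_form]
          by_cases hl : x'.1.left = x.1.left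
          · have : x' = x := Subtype.ext (SemidirectProduct.ext hl ht)
            simp [this]
          · simp [hl]
        · simp [hg]
      · simp [ht]
    · simp [hm]
  have hmem : form k 1 g x ∈ N := by
    have h2 := hN.rightSlice_mem (coord k φ 1 (g * x.1.left⁻¹)) _ <|
      hN.leftSlice_mem (coord k φ m g) _ <|
      hN.rightMul_mem (δ k φ (m * x.1.right) 1) _ <| hN.leftMul_mem (δ k φ m 1) _ hω
    have h3 := LinearMap.congr_fun key ω
    simp only [LinearMap.comp_apply] at h3
    rw [h3, LinearMap.smulRight_apply, Finsupp.lapply_apply] at h2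
    exact (N.smul_mem_iff hi).1 h2
  rw [eq_top_iff, ← (Finsupp.basisSingleOne (R := k)).span_eq, Submodule.span_le]
  rintro _ ⟨⟨m', g', x'⟩, rfl⟩
  rw [Finsupp.coe_basisSingleOne]
  exact hN.form_mem hmem m' g' x'

theorem isIrreducible_classCalculus (h : t₀ ≠ 1) :
    (classCalculus k φ t₀ h).IsIrreducible := by
  have : Nontrivial (Form k φ t₀) := by
    have : Nonempty (M × G × conjugatesOf (inr t₀ : G ⋊[φ] M)) :=
      ⟨1, 1, _, IsConj.refl _⟩
    exact Finsupp.instNontrivial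
  refine ⟨this, fun N h1 h2 h3 h4 => IsStable.eq_bot_or_eq_top ⟨h1, h2, ?_, ?_⟩⟩
  · exact fun f ω hω => lid_rTensor_mem f (h3 ω hω)
  · exact fun f ω hω => rid_lTensor_mem f (h4 ω hω)

/-! ### Left-invariant forms and the dimension. -/

variable (k) in
/-- The left-invariant 1-forms attached to the elements of the conjugacy class. -/
def invForm (x : conjugatesOf (inr t₀ : G ⋊[φ] M)) : Form k φ t₀ :=
  ∑ m : M, form k m 1 x

omit [Fintype G] in
theorem invForm_apply (x y : conjugatesOf (inr t₀ : G ⋊[φ] M)) [Decidable (x = y)] :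
    invForm k x (1, 1, y) = if x = y then 1 else 0 := by
  classical
  simp only [invForm, form, Finsupp.coe_finsetSum, Finset.sum_apply, Finsupp.single_apply,
    Prod.mk.injEq]
  by_cases h : x = y <;> simp [h]

theorem linearIndependent_invForm :
    LinearIndependent k (invForm k : conjugatesOf (inr t₀ : G ⋊[φ] M) → Form k φ t₀) := by
  classical
  rw [Fintype.linearIndependent_iff]
  intro c hc y
  have h := DFunLike.congr_fun hc (1, 1, y)
  simpa [Finsupp.coe_finsetSum, invForm_apply] using h

omit [Fintype G] [DecidableEq G] in
theorem leftCoact_invForm (x : conjugatesOf (inr t₀ : G ⋊[φ] M)) :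
    leftCoact k φ t₀ (invForm k x) = 1 ⊗ₜ[k] invForm k x := by
  simp only [invForm, map_sum, leftCoact_form, map_one]
  rw [Finset.sum_comm, TensorProduct.tmul_sum, one_eq]
  refine Finset.sum_congr rfl fun b _ => ?_
  rw [TensorProduct.sum_tmul]
  exact Fintype.sum_equiv (Equiv.mulRight b⁻¹) _ _ fun c => rfl

variable (k φ t₀) in
/-- The projection of the 1-forms onto the left-invariant ones. -/
def formProj : Form k φ t₀ →ₗ[k] Form k φ t₀ :=
  TensorProduct.lift (leftMul k φ t₀ ∘ₗ HopfAlgebra.antipode k) ∘ₗ leftCoact k φ t₀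

theorem formProj_form (m : M) (g : G) (x : conjugatesOf (inr t₀ : G ⋊[φ] M)) :
    formProj k φ t₀ (form k m g x) = if m = 1 then invForm k x else 0 := by
  simp only [formProj, LinearMap.comp_apply, leftCoact_form, map_sum, TensorProduct.lift.tmul,
    antipode_δ, leftMul_δ, mul_inv_rev, inv_inv, mul_eq_left, inv_eq_one]
  split_ifs with hm
  · simp [hm, invForm]
  · simp

theorem formProj_of_invariant {ω : Form k φ t₀} (hω : leftCoact k φ t₀ ω = 1 ⊗ₜ ω) :
    formProj k φ t₀ ω = ω := by
  rw [formProj, LinearMap.comp_apply, hω, TensorProduct.lift.tmul, LinearMap.comp_apply,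
    HopfAlgebra.antipode_one]
  exact LinearMap.congr_fun (map_one (leftAct k φ t₀)) ω

theorem range_formProj_le : LinearMap.range (formProj k φ t₀) ≤
    Submodule.span k (Set.range (invForm k)) := by
  rw [LinearMap.range_eq_map, ← (Finsupp.basisSingleOne (R := k)).span_eq, Submodule.map_span,
    Submodule.span_le]
  rintro _ ⟨_, ⟨⟨m, g, x⟩, rfl⟩, rfl⟩
  rw [Finsupp.coe_basisSingleOne]
  change formProj k φ t₀ (form k m g x) ∈ _
  rw [formProj_form]
  split_ifs
  · exact Submodule.subset_span ⟨x, rfl⟩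
  · exact Submodule.zero_mem _

/-- Invariant forms are fixed by `formProj`, whose range lies in the span of the `invForm k x`. -/
theorem invariantForms_classCalculus (h : t₀ ≠ 1) :
    ((classCalculus k φ t₀ h).invariantForms : Submodule k (Form k φ t₀)) =
      Submodule.span k (Set.range (invForm k)) := by
  refine le_antisymm (fun ω hω => ?_) (Submodule.span_le.2 ?_)
  · exact range_formProj_le ⟨ω, formProj_of_invariant hω⟩
  · rintro _ ⟨x, rfl⟩
    exact leftCoact_invForm x

theorem dimension_classCalculus (h : t₀ ≠ 1) : (classCalculus k φ t₀ h).dimension =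
    Fintype.card (conjugatesOf (inr t₀ : G ⋊[φ] M)) :=
  (congrArg (fun N : Submodule k (Form k φ t₀) => Module.finrank k N)
    (invariantForms_classCalculus h)).trans (finrank_span_eq_card linearIndependent_invForm)

/-! ### The quantum tangent space of the class calculus. -/

variable (k) in
/-- The element of the dual of `k(M) ◁< kG` attached to an element of `X`. -/
def tangentVector (x : G ⋊[φ] M) : Module.Dual k (CrossCoproduct k φ) :=
  lift k φ fun s u => (if inl u * x * (inl u)⁻¹ = inr s then 1 else 0) -
    if s = 1 ∧ x.left = 1 then 1 else 0

theorem tangentVector_δ (x : G ⋊[φ] M) (s : M) (u : G) : tangentVector k x (δ k φ s u) =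
    (if inl u * x * (inl u)⁻¹ = inr s then 1 else 0) -
      if s = 1 ∧ x.left = 1 then 1 else 0 :=
  lift_δ _ _ _

variable (k φ t₀) in
/-- The Maurer-Cartan map in terms of the invariant forms and the tangent vectors. -/
def formMaurerCartan : CrossCoproduct k φ →ₗ[k] Form k φ t₀ :=
  ∑ x : conjugatesOf (inr t₀ : G ⋊[φ] M), (tangentVector k x.1).smulRight (invForm k x)

/-- The part `θ a`, reindexed by `x ↦ u⁻¹ x u`, gives the first term of `tangentVector`, and `a θ`
the second. -/
theorem formProj_comp_diff : formProj k φ t₀ ∘ₗ diff k φ t₀ = formMaurerCartan k φ t₀ := by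
  refine hom_ext fun s u => ?_
  simp only [formMaurerCartan, LinearMap.sum_apply, LinearMap.smulRight_apply, tangentVector_δ,
    sub_smul, Finset.sum_sub_distrib]
  rw [LinearMap.comp_apply, diff_apply, map_sub]
  congr 1
  · rw [rightMul_theta, map_sum]
    refine Fintype.sum_equiv (conjEquiv (inl u⁻¹)) _ _ fun x => ?_
    rw [apply_ite (formProj k φ t₀), formProj_form, map_zero]
    have : inl u * (conjEquiv (inl u⁻¹) x).1 * (inl u)⁻¹ = x.1 := by
      simp [conjEquiv, conjBy, mul_assoc]
    rw [this]
    have hx : x.1 = inr s ↔ x.1.left = 1 ∧ s * x.1.right⁻¹ = 1 := by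
      rw [SemidirectProduct.ext_iff, mul_inv_eq_one, eq_comm (a := s)]
      simp
    simp only [hx]
    by_cases h1 : x.1.left = 1 <;> by_cases h2 : s * x.1.right⁻¹ = 1 <;>
      simp [h1, h2, conjEquiv]
  · rw [leftMul_theta, map_sum]
    refine Finset.sum_congr rfl fun x _ => ?_
    rw [apply_ite (formProj k φ t₀), formProj_form, map_zero]
    by_cases hs : s = 1 <;> by_cases hx : x.1.left = 1 <;> simp [hs, hx]

theorem maurerCartan_classCalculus (h : t₀ ≠ 1) :
    ((classCalculus k φ t₀ h).maurerCartan : CrossCoproduct k φ →ₗ[k] Form k φ t₀) =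
      formMaurerCartan k φ t₀ := by
  rw [← formProj_comp_diff]
  -- By definition `formProj` is the `invProj` of this calculus.
  exact LinearMap.ext fun a => ((classCalculus k φ t₀ h).invProj_d a).symm

theorem range_dualMap_formMaurerCartan : LinearMap.range (formMaurerCartan k φ t₀).dualMap =
      Submodule.span k (Set.range fun x : conjugatesOf (inr t₀ : G ⋊[φ] M) =>
        tangentVector k x.1) := by
  classical
  have h : ∀ f : Module.Dual k (Form k φ t₀), (formMaurerCartan k φ t₀).dualMap f =
      ∑ x : conjugatesOf (inr t₀ : G ⋊[φ] M), f (invForm k x) • tangentVector k x.1 := by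
    intro f
    ext a
    simp [formMaurerCartan, LinearMap.sum_apply, mul_comm]
  refine le_antisymm ?_ (Submodule.span_le.2 ?_)
  · rintro _ ⟨f, rfl⟩
    rw [h]
    exact Submodule.sum_mem _ fun x _ =>
      Submodule.smul_mem _ _ (Submodule.subset_span ⟨x, rfl⟩)
  · rintro _ ⟨x, rfl⟩
    refine ⟨Finsupp.lapply (1, 1, x), ?_⟩
    rw [h]
    simp [invForm_apply]

theorem tangentSpace_classCalculus (h : t₀ ≠ 1) :
    (classCalculus k φ t₀ h).tangentSpace =
      Submodule.span k (Set.range fun x : conjugatesOf (inr t₀ : G ⋊[φ] M) =>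
        tangentVector k x.1) :=
  (congrArg (fun f : CrossCoproduct k φ →ₗ[k] Form k φ t₀ => LinearMap.range f.dualMap)
    (maurerCartan_classCalculus h)).trans range_dualMap_formMaurerCartan

/-- Write `y = u t u⁻¹` with `t ∈ M`. Evaluation at `δ_t ⊗ u⁻¹` isolates the coefficient of `y`: the
subtracted term vanishes as `t ≠ e`. -/
theorem linearIndependent_tangentVector (h : t₀ ≠ 1) :
    LinearIndependent k fun x : conjugatesOf (inr t₀ : G ⋊[φ] M) => tangentVector k x.1 := by
  classical
  rw [Fintype.linearIndependent_iff]
  intro c hc y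
  obtain ⟨u, x, hx, rfl⟩ := exists_eq_conjBy y
  have hr : x.1.right ≠ 1 := fun h1 => h (isConj_one_left.1 (h1 ▸ isConj_right x))
  have h1 := LinearMap.congr_fun hc (δ k φ x.1.right u⁻¹)
  have h2 : ∀ z : conjugatesOf (inr t₀ : G ⋊[φ] M),
      inl u⁻¹ * z.1 * (inl u⁻¹)⁻¹ = inr x.1.right ↔ z = conjBy (inl u) x := by
    intro z
    have : inr x.1.right = x.1 := by ext <;> simp [hx]
    rw [this, Subtype.ext_iff, conjBy, map_inv, inv_inv, eq_mul_inv_iff_mul_eq, mul_assoc,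
      inv_mul_eq_iff_eq_mul]
  simp only [map_inv, inv_inv] at h2
  simpa [LinearMap.sum_apply, tangentVector_δ, hr, h2] using h1

/-! ### The image `Π(𝓜)`. -/

theorem proj_apply_δ (s : M) (u : G) (p : (G ⋊[φ] M) →₀ k) : proj k φ p (δ k φ s u) =
    p (inl u * inr s) - if s = 1 then ∑ t : M, p (inr t) else 0 := by
  have h : (Module.Dual.eval k _ (δ k φ s u)) ∘ₗ proj k φ =
      Finsupp.lapply (inl u * inr s) -
        if s = 1 then ∑ t : M, Finsupp.lapply (inr t : G ⋊[φ] M) else 0 := by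
    refine Finsupp.lhom_ext' fun x => LinearMap.ext_ring ?_
    have h1 : x = inl u * inr s ↔ s = x.right ∧ u = x.left := by
      rw [SemidirectProduct.ext_iff]
      simp [eq_comm, and_comm]
    generalize (inl u * inr s : G ⋊[φ] M) = y at h1 ⊢
    have h2 : ∀ t, x = inr t ↔ t = x.right ∧ x.left = 1 := by
      intro t
      rw [SemidirectProduct.ext_iff]
      simp [eq_comm, and_comm]
    by_cases hs : s = 1 <;> by_cases hx : x.left = 1 <;>
      simp [proj, coord_δ, counit_δ, Finsupp.single_apply, h1, h2, hs, hx]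
  have := LinearMap.congr_fun h p
  rw [LinearMap.comp_apply, Module.Dual.eval_apply] at this
  rw [this]
  split_ifs <;> simp

/-- The degree `u⁻¹ s⁻¹ u` of `us` is `z` exactly when `u z⁻¹ u⁻¹ = s`. The fibre over `z` meets `M`
in one point if `z ∈ M` and in none otherwise. -/
theorem proj_fibreSum (z : G ⋊[φ] M) : proj k φ (fibreSum k z) = tangentVector k z⁻¹ := by
  refine hom_ext fun s u => ?_
  simp only [proj_apply_δ, tangentVector_δ, fibreSum_apply]
  congr 1
  · refine if_congr ?_ rfl rfl
    rw [eq_comm, degree]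
    simp only [SemidirectProduct.mul_left, SemidirectProduct.mul_right,
      SemidirectProduct.left_inl, SemidirectProduct.left_inr, SemidirectProduct.right_inl,
      SemidirectProduct.right_inr, map_one, mul_one, one_mul]
    rw [← inv_inj, mul_inv_rev, mul_inv_rev, inv_inv, inv_inv, eq_inv_mul_iff_mul_eq]
    exact mul_inv_eq_iff_eq_mul.symm
  · have h1 : ∀ t : M, degree (inr t : G ⋊[φ] M) = z ↔ t = z.right⁻¹ ∧ z.left = 1 := by
      intro t
      rw [SemidirectProduct.ext_iff, and_comm, ← inv_eq_iff_eq_inv]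
      simp [degree, eq_comm]
    have h2 : z⁻¹.left = 1 ↔ z.left = 1 := by simp
    simp only [h1, h2]
    by_cases hs : s = 1 <;> by_cases hz : z.left = 1 <;> simp [hs, hz]

theorem map_proj_translates (t₀ : M) : (translates k φ t₀).map (proj k φ) =
    Submodule.span k (Set.range fun x : conjugatesOf (inr t₀ : G ⋊[φ] M) =>
      tangentVector k x.1) := by
  rw [translates_eq, Submodule.map_span, conjugatesOf_inr_inv, Set.image_image, Set.image_image]
  simp only [proj_fibreSum, inv_inv, Set.image_eq_range]

omit [DecidableEq G] [DecidableEq M] in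
theorem ncard_conjugatesOf (t₀ : M) : (conjugatesOf (inr t₀⁻¹ : G ⋊[φ] M)).ncard =
    Fintype.card (conjugatesOf (inr t₀ : G ⋊[φ] M)) := by
  rw [conjugatesOf_inr_inv, Set.ncard_image_of_injective _ inv_injective,
    ← Nat.card_eq_fintype_card]
  rfl

/-! ### The case `t₀ = e` and the null calculus. -/

theorem map_proj_translates_one :
    (translates k φ 1).map (proj k φ) = ⊥ := by
  rw [map_proj_translates, Submodule.span_eq_bot]
  rintro _ ⟨⟨x, hx⟩, rfl⟩
  obtain rfl : x = 1 := isConj_one_right.1 (show IsConj 1 x by rw [← map_one inr]; exact hx)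
  -- At `x = 1` both terms of the tangent vector are the indicator of `s = 1`.
  refine hom_ext fun s u => ?_
  rw [tangentVector_δ]
  have : (1 : G ⋊[φ] M) = inr s ↔ s = 1 := by
    rw [SemidirectProduct.ext_iff]
    simp [eq_comm]
  simp [this]

end ClassCalculus

/-- The null calculus. -/
def nullCalculus.{w₁, u, v} (k : Type u) (A : Type v) [Field k] [Ring A] [HopfAlgebra k A] :
    BicovariantCalculus.{w₁} k A where
  Ω := PUnit
  lact := AlgHom.ofLinearMap 0 (Subsingleton.elim _ _) fun _ _ => Subsingleton.elim _ _
  ract := AlgHom.ofLinearMap 0 (Subsingleton.elim _ _) fun _ _ => Subsingleton.elim _ _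
  lact_ract _ _ _ := rfl
  d := 0
  leibniz _ _ := rfl
  span_d := Subsingleton.elim _ _
  coL := 0
  coR := 0
  coL_counit _ := rfl
  coL_coassoc ω := by simp
  coR_counit _ := rfl
  coR_coassoc ω := by simp
  coL_coR ω := by simp
  coL_lmul a ω := by simp
  coL_rmul a ω := by simp
  coR_lmul a ω := by simp
  coR_rmul a ω := by simp
  coL_d a := by simp
  coR_d a := by simp

theorem tangentSpace_nullCalculus (k A : Type*) [Field k] [Ring A] [HopfAlgebra k A] :
    (nullCalculus k A).tangentSpace = ⊥ := by
  rw [BicovariantCalculus.tangentSpace, LinearMap.range_eq_bot]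
  ext f a
  rw [LinearMap.dualMap_apply, show (nullCalculus k A).maurerCartan a = 0 from rfl]
  simp

end

end NCCalc

/-! ### The main theorem. -/

theorem mainTheorem6
    {k : Type uk} [Field k] [CharZero k]
    {G : Type uG} {M : Type uM} [Group G] [Fintype G] [DecidableEq G]
    [Group M] [Fintype M] [DecidableEq M]
    (φ : M →* MulAut G) (t₀ : M) :
    -- (i) the conjugacy class of `t₀⁻¹` in `X = G ⋊ M`
    conjugatesOf (inr t₀⁻¹ : G ⋊[φ] M) =
      {x | ∃ t ∈ conjugatesOf t₀⁻¹, ∃ u : G, x = inl (u⁻¹ * φ t u) * inr t} ∧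
    -- (ii) the fibre of the degree map over `t₀⁻¹`
    (degree ⁻¹' {(inr t₀⁻¹ : G ⋊[φ] M)} = {x | ∃ u ∈ fixSubgroup φ t₀, x = inl u * inr t₀}) ∧
    -- (iii) the centralizer of `t₀` in `X`
    ((Subgroup.centralizer {(inr t₀ : G ⋊[φ] M)} : Set (G ⋊[φ] M)) =
      {x | ∃ u ∈ fixSubgroup φ t₀, ∃ s ∈ Subgroup.centralizer {t₀}, x = inl u * inr s}) ∧
    -- (iv) the action of the centralizer on `J_0`
    ((∀ x ∈ Subgroup.centralizer {(inr t₀ : G ⋊[φ] M)},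
        (fibreSpace k (inr t₀⁻¹ : G ⋊[φ] M)).map (linAct k x) ≤ fibreSpace k (inr t₀⁻¹)) ∧
      ∀ v ∈ fixSubgroup φ t₀, ∀ u ∈ fixSubgroup φ t₀, ∀ s ∈ Subgroup.centralizer {t₀},
        crossAct (inl v * inr t₀ : G ⋊[φ] M) (inl u * inr s) =
          inl (φ s⁻¹ (v * u)) * inr t₀) ∧
    -- (v) `k m_0` is a one-dimensional trivial subrepresentation of `J_0`
    (Submodule.span k {m₀ k φ t₀} ≤ fibreSpace k (inr t₀⁻¹) ∧
      Module.finrank k (Submodule.span k {m₀ k φ t₀}) = 1 ∧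
      ∀ x ∈ Subgroup.centralizer {(inr t₀ : G ⋊[φ] M)},
        ∀ m ∈ Submodule.span k {m₀ k φ t₀}, linAct k x m = m) ∧
    -- `𝓜` is the direct sum of the lines `k (m_0 ◁~ z̄)`, for any choice of the `z̄`
    (∀ zbar : (conjugatesOf (inr t₀⁻¹ : G ⋊[φ] M)) → G ⋊[φ] M,
      (∀ z, (zbar z)⁻¹ * inr t₀⁻¹ * zbar z = (z : G ⋊[φ] M)) →
        LinearIndependent k (fun z => linAct k (zbar z) (m₀ k φ t₀)) ∧
        Submodule.span k (Set.range fun z => linAct k (zbar z) (m₀ k φ t₀)) =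
          translates k φ t₀) ∧
    -- `𝓜` depends only on the conjugacy class of `t₀` in `M`
    (∀ t₁ : M, IsConj t₀ t₁ → translates k φ t₁ = translates k φ t₀) ∧
    -- the canonical calculus, irreducible of dimension `|C^X|` unless `t₀ = e`, when it is null
    (∃ Γ : BicovariantCalculus.{max uk uG uM} k (CrossCoproduct k φ),
      Γ.tangentSpace = (translates k φ t₀).map (proj k φ) ∧
      (∀ Γ' : BicovariantCalculus.{w} k (CrossCoproduct k φ),
        Γ'.tangentSpace = (translates k φ t₀).map (proj k φ) → Γ.Isomorphic Γ') ∧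
      (t₀ ≠ 1 → Γ.IsIrreducible ∧
        Γ.dimension = (conjugatesOf (inr t₀⁻¹ : G ⋊[φ] M)).ncard ∧
        Module.finrank k ((translates k φ t₀).map (proj k φ)) =
          (conjugatesOf (inr t₀⁻¹ : G ⋊[φ] M)).ncard) ∧
      (t₀ = 1 → Subsingleton Γ.Ω)) := by
  refine ⟨?_, preimage_degree t₀, centralizer_inr t₀, ⟨?_, ?_⟩, ⟨?_, ?_, ?_⟩, ?_, ?_, ?_⟩
  · exact conjugatesOf_inr t₀⁻¹
  · intro x hx
    have h := map_linAct_fibreSpace k (inr t₀⁻¹) x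
    rwa [inv_mul_inr_inv_mul hx] at h
  · intro v _ u _ s hs
    rw [Subgroup.mem_centralizer_singleton_iff] at hs
    ext
    · simp [crossAct]
    · simp [crossAct, mul_assoc, ← hs]
  · rw [Submodule.span_singleton_le_iff_mem, m₀_eq]
    exact fibreSum_mem_fibreSpace k _
  · exact finrank_span_singleton (m₀_ne_zero k t₀)
  · intro x hx m hm
    obtain ⟨c, rfl⟩ := Submodule.mem_span_singleton.1 hm
    rw [map_smul, linAct_m₀_of_mem_centralizer k hx]
  · exact fun zbar hz => ⟨linearIndependent_linAct_m₀ k t₀ zbar hz, span_linAct_m₀ k t₀ zbar hz⟩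
  · exact fun t₁ h => translates_eq_of_isConj k h
  · by_cases ht : t₀ = 1
    · subst ht
      have h : (nullCalculus k (CrossCoproduct k φ)).tangentSpace =
          (translates k φ 1).map (proj k φ) := by
        rw [tangentSpace_nullCalculus, ClassCalculus.map_proj_translates_one]
      exact ⟨nullCalculus k (CrossCoproduct k φ), h,
        fun Γ' h' => BicovariantCalculus.isomorphic_of_tangentSpace_eq (h.trans h'.symm),
        fun h1 => absurd rfl h1, fun _ => inferInstanceAs (Subsingleton PUnit)⟩
    · have h : (classCalculus k φ t₀ ht).tangentSpace = (translates k φ t₀).map (proj k φ) := by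
        rw [ClassCalculus.tangentSpace_classCalculus, ClassCalculus.map_proj_translates]
      refine ⟨classCalculus k φ t₀ ht, h,
        fun Γ' h' => BicovariantCalculus.isomorphic_of_tangentSpace_eq (h.trans h'.symm),
        fun _ => ⟨ClassCalculus.isIrreducible_classCalculus ht, ?_, ?_⟩, fun h1 => absurd h1 ht⟩
      · rw [ClassCalculus.ncard_conjugatesOf, ClassCalculus.dimension_classCalculus]
      · rw [ClassCalculus.ncard_conjugatesOf, ClassCalculus.map_proj_translates]
        exact finrank_span_eq_card (ClassCalculus.linearIndependent_tangentVector ht)
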